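/- Let $\lambda>0$ and $0<\theta\le \pi/2$. For $v\in\mathbb R^2$ put $\mathcal C_\theta(v)=v+\mathcal C_\theta$, where $\mathcal C_\theta=\{(r\cos\varphi,r\sin\varphi): r>0,\ |\varphi|\le\theta\}$, and let $\mathcal C^o_\theta$ be the interior of $\mathcal C_\theta$. Let $\mathcal P_\lambda$ be a homogeneous Poisson point process on $\mathbb R^2$ with intensity $\lambda$. The directed-$\theta$-navigation is the sequence $V_0=0$, $V_{i+1}=\operatorname{argmin}\{|v-V_i|: v\in\mathcal P_\lambda\cap\mathcal C_\theta(V_i)\}$, and $U_1=V_1-V_0$ is its first progress variable. Let $\tilde U_1,\tilde U_2,\dots$ be iid copies of $U_1$. For $\gamma=(\gamma_1,\gamma_2)\in\mathbb R^2$ and $u\in\mathbb R^2$ set $$J_{\lambda,\theta}(\gamma)=\log\Big(\lambda\int_0^\infty r e^{-\lambda\theta r^2}\int_{-\theta}^{\theta} e^{\gamma_1 r\cos\varphi+\gamma_2 r\sin\varphi}\,d\varphi\,dr\Big),\qquad \mathcal I_{\lambda,\theta}(u)=\sup_{\gamma\in\mathbb R^2}\big\{\langle\gamma,u\rangle-J_{\lambda,\theta}(\gamma)\big\}.$$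 Then: 1. The empirical means $n^{-1}\sum_{i=1}^n\tilde U_i$ satisfy the large-deviation principle with speed $n$ and rate function $\mathcal I_{\lambda,\theta}$. That is, $\mathcal I_{\lambda,\theta}:\mathbb R^2\to[0,\infty]$ is lower semicontinuous; for every closed $F\subset\mathbb R^2$, $\limsup_{n\to\infty}\frac1n\log\mathbb P\big(n^{-1}\sum_{i=1}^n\tilde U_i\in F\big)\le-\inf_F\mathcal I_{\lambda,\theta}$; and for every open $G\subset\mathbb R^2$, $\liminf_{n\to\infty}\frac1n\log\mathbb P\big(n^{-1}\sum_{i=1}^n\tilde U_i\in G\big)\ge-\inf_G\mathcal I_{\lambda,\theta}$. 2. $J_{\lambda,\theta}$ is the log-moment generating function of $U_1$, i.e. $J_{\lambda,\theta}(\gamma)=\log\mathbb E[e^{\langle\gamma,U_1\rangle}]$, and $-\infty<J_{\lambda,\theta}(\gamma)<\infty$, for all $\gamma\in\mathbb R^2$. 3. $\{u\in\mathbb R^2:\mathcal I_{\lambda,\theta}(u)<\infty\}=\mathcal C^o_\theta$, and $\mathcal I_{\lambda,\theta}$ is continuous on this set. -/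

import Mathlib

open MeasureTheory ProbabilityTheory Filter Set

noncomputable section

/-- The Euclidean plane. -/
abbrev Plane : Type := EuclideanSpace ℝ (Fin 2)

/-- The point of the plane with polar coordinates `(r, φ)`. -/
def polarPoint (r φ : ℝ) : Plane := !₂[r * Real.cos φ, r * Real.sin φ]

/-- The cone with apex at the origin (apex excluded), axis `e₁` and opening angle `2θ`. -/
def navCone (θ : ℝ) : Set Plane :=
  {v | ∃ r φ : ℝ, 0 < r ∧ |φ| ≤ θ ∧ v = polarPoint r φ}

/-- The translated cone `v + C_θ`. -/
def navConeAt (θ : ℝ) (v : Plane) : Set Plane := {w | w - v ∈ navCone θ}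

/-- `w` is a nearest point to `v` among the points of `S` in the cone at `v`. -/
def IsNearestInCone (θ : ℝ) (S : Set Plane) (v w : Plane) : Prop :=
  w ∈ S ∩ navConeAt θ v ∧ ∀ w' ∈ S ∩ navConeAt θ v, ‖w - v‖ ≤ ‖w' - v‖

open Classical in
/-- The successor of `v`: the unique minimiser of `|w - v|` over `w ∈ S ∩ C_θ(v)`. For a Poisson
process it exists almost surely; the value `v` is used when there is no unique minimiser. -/
def successor (θ : ℝ) (S : Set Plane) (v : Plane) : Plane :=
  if h : ∃! w, IsNearestInCone θ S v w then h.choose else v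

/-- The directed-`θ`-navigation on the point set `S`, started at the origin. -/
def navigation (θ : ℝ) (S : Set Plane) : ℕ → Plane
  | 0 => 0
  | n + 1 => successor θ S (navigation θ S n)

/-- The `i`-th progress `V_i - V_{i-1}` of the navigation (`i ≥ 1`). -/
def progress (θ : ℝ) (S : Set Plane) (i : ℕ) : Plane :=
  navigation θ S i - navigation θ S (i - 1)

/-- `P` is a (simple) Poisson point process with intensity measure `μ`, given as a random set of
points: the number of points in a Borel set `B` of finite `μ`-measure is Poisson distributed with
parameter `μ B`, and the numbers of points in disjoint Borel sets are independent. -/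
structure IsPoissonProcess {Ω E : Type*} [MeasurableSpace Ω] [MeasurableSpace E]
    (P : Ω → Set E) (μ : Measure E) (Pr : Measure Ω) : Prop where
  measurable_count : ∀ B : Set E, MeasurableSet B → Measurable fun ω => (P ω ∩ B).encard
  hasLaw_count : ∀ B : Set E, MeasurableSet B → μ B ≠ ⊤ →
    HasLaw (fun ω => (P ω ∩ B).encard)
      ((poissonMeasure (μ B).toNNReal).map (fun k : ℕ => (k : ℕ∞))) Pr
  iIndepFun_count : ∀ (m : ℕ) (B : Fin m → Set E), (∀ i, MeasurableSet (B i)) →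
    Pairwise (fun i j => Disjoint (B i) (B j)) →
    iIndepFun (fun i ω => (P ω ∩ B i).encard) Pr

/-- The random variables `Z n` satisfy the large-deviation principle with speed `a n` and rate
function `I : E → [0, ∞]`. -/
structure SatisfiesLDP {Ω E : Type*} [MeasurableSpace Ω] [TopologicalSpace E]
    (Pr : Measure Ω) (Z : ℕ → Ω → E) (a : ℕ → ℝ) (I : E → EReal) : Prop where
  nonneg : ∀ x, 0 ≤ I x
  lowerSemicontinuous : LowerSemicontinuous I
  upper_bound : ∀ F : Set E, IsClosed F →
    limsup (fun n => ENNReal.log (Pr (Z n ⁻¹' F)) / ((a n : ℝ) : EReal)) atTop ≤ -⨅ x ∈ F, I x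
  lower_bound : ∀ G : Set E, IsOpen G →
    -⨅ x ∈ G, I x ≤ liminf (fun n => ENNReal.log (Pr (Z n ⁻¹' G)) / ((a n : ℝ) : EReal)) atTop

/-- The explicit function `J_{lam,θ}` as an extended real number; the integrand is positive, so the
iterated integral is taken in `[0, ∞]`. -/
def explicitJ (lam θ : ℝ) (γ : Plane) : EReal :=
  ENNReal.log (ENNReal.ofReal lam *
    ∫⁻ r in Ioi (0 : ℝ), ENNReal.ofReal (r * Real.exp (-lam * θ * r ^ 2)) *
      ∫⁻ φ in Icc (-θ) θ,
        ENNReal.ofReal (Real.exp (γ 0 * r * Real.cos φ + γ 1 * r * Real.sin φ)))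

/-- The Legendre transform `I_{lam,θ}` of `J_{lam,θ}`. -/
def rateFunction (lam θ : ℝ) (u : Plane) : EReal :=
  ⨆ γ : Plane, ((inner ℝ γ u : ℝ) : EReal) - explicitJ lam θ γ

end

/-! The progress lands near `x` in the cone only if the sector of radius `‖x‖`, of area `θ‖x‖²`,
contains no point. Hence `U₁` has density `λ exp(-λθ‖x‖²)` on the cone (`map_progress_one`). Only
the upper bound for the law is proved set by set. Equality follows because both measures have mass
one. In polar coordinates the moment generating function becomes the explicit `J`, and the Gaussian
tail makes it finite everywhere.

The large-deviation principle is Cramér's theorem (`satisfiesLDP_cramerRate`). The upper bound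
combines Chernoff's inequality with a finite cover of the closed set. For the lower bound at `u`,
take a minimiser `γ` of `E exp⟪γ, X - u⟫`. The first-order condition there shows that sample means
far from `u` contribute exponentially little to `E exp⟪γ, S_n⟫`, so the means near `u` must carry
it.

If `u` is interior to the cone, the law charges a ball beyond `u` in every direction with mass
bounded below. So `E exp⟪γ, X - u⟫` grows exponentially in `‖γ‖`, which gives both the minimiser and
a finite rate (`exists_pos_mul_exp_le`). Otherwise some side normal `n` has `⟪n, u⟫ ≤ 0` but `⟪n, X⟫
> 0` almost surely, and `γ = -k n` drives the rate to infinity (`cramerRate_eq_top`). Continuity is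
that of a finite convex function on an open convex set. -/

/-! ### Geometry of the cone and integration in polar coordinates. -/

/-- The inner normals `(sin θ, s cos θ)`, `s = ±1`, to the two sides of the cone. -/
noncomputable def coneNormal (θ s : ℝ) : Plane := !₂[Real.sin θ, s * Real.cos θ]

theorem inner_plane (x y : Plane) : inner ℝ x y = x 0 * y 0 + x 1 * y 1 := by
  simp [PiLp.inner_apply, Fin.sum_univ_two, mul_comm]

theorem inner_coneNormal (θ s : ℝ) (x : Plane) :
    inner ℝ (coneNormal θ s) x = Real.sin θ * x 0 + s * Real.cos θ * x 1 := by
  simp [inner_plane, coneNormal]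

theorem norm_sq_plane (x : Plane) : ‖x‖ ^ 2 = x 0 ^ 2 + x 1 ^ 2 := by
  simp [EuclideanSpace.norm_sq_eq, Fin.sum_univ_two]

theorem norm_polarPoint {r : ℝ} (hr : 0 ≤ r) (φ : ℝ) : ‖polarPoint r φ‖ = r := by
  rw [← sq_eq_sq₀ (norm_nonneg _) hr, norm_sq_plane]
  simp only [polarPoint, PiLp.toLp_apply, Matrix.cons_val_zero, Matrix.cons_val_one]
  linear_combination r ^ 2 * Real.cos_sq_add_sin_sq φ

theorem inner_coneNormal_one_polarPoint (θ r φ : ℝ) :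
    inner ℝ (coneNormal θ 1) (polarPoint r φ) = r * Real.sin (θ + φ) := by
  rw [inner_coneNormal, Real.sin_add]
  simp [polarPoint]; ring

theorem inner_coneNormal_neg_one_polarPoint (θ r φ : ℝ) :
    inner ℝ (coneNormal θ (-1)) (polarPoint r φ) = r * Real.sin (θ - φ) := by
  rw [inner_coneNormal, Real.sin_sub]
  simp [polarPoint]; ring

theorem exists_polarPoint {x : Plane} (hx : x ≠ 0) :
    ∃ r φ : ℝ, 0 < r ∧ -Real.pi < φ ∧ φ ≤ Real.pi ∧ x = polarPoint r φ := by
  have hz : (⟨x 0, x 1⟩ : ℂ) ≠ 0 := by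
    intro h
    apply hx
    ext i
    fin_cases i
    · exact congrArg Complex.re h
    · exact congrArg Complex.im h
  refine ⟨‖(⟨x 0, x 1⟩ : ℂ)‖, Complex.arg ⟨x 0, x 1⟩, norm_pos_iff.2 hz,
    Complex.neg_pi_lt_arg _, Complex.arg_le_pi _, ?_⟩
  ext i
  fin_cases i
  · simp [polarPoint, Complex.norm_mul_cos_arg]
  · simp [polarPoint, Complex.norm_mul_sin_arg]

section Cone

variable {θ : ℝ}

/-- The angle witnessing membership may differ from `φ`. The inner products with the normals do not
depend on the representation, and the signs of `sin (θ ± φ)` detect `|φ| ≤ θ` on `(-π, π]`. -/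
theorem polarPoint_mem_navCone_iff (hθ : 0 < θ) (hθ' : θ ≤ Real.pi / 2) {r φ : ℝ} (hr : 0 < r)
    (h1 : -Real.pi < φ) (h2 : φ ≤ Real.pi) :
    polarPoint r φ ∈ navCone θ ↔ |φ| ≤ θ := by
  refine ⟨?_, fun h => ⟨r, φ, hr, h, rfl⟩⟩
  rintro ⟨r', φ', hr', hφ', h⟩
  have e1 := congrArg (inner ℝ (coneNormal θ 1)) h
  have e2 := congrArg (inner ℝ (coneNormal θ (-1))) h
  rw [inner_coneNormal_one_polarPoint, inner_coneNormal_one_polarPoint] at e1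
  rw [inner_coneNormal_neg_one_polarPoint, inner_coneNormal_neg_one_polarPoint] at e2
  rw [abs_le] at hφ' ⊢
  have s1 : 0 ≤ Real.sin (θ + φ') :=
    Real.sin_nonneg_of_nonneg_of_le_pi (by linarith) (by linarith)
  have s2 : 0 ≤ Real.sin (θ - φ') :=
    Real.sin_nonneg_of_nonneg_of_le_pi (by linarith) (by linarith)
  constructor
  · by_contra! hc
    have := Real.sin_neg_of_neg_of_neg_pi_lt (x := θ + φ) (by linarith) (by linarith)
    nlinarith
  · by_contra! hc
    have := Real.sin_neg_of_neg_of_neg_pi_lt (x := θ - φ) (by linarith) (by linarith)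
    nlinarith

/-- Since `θ ≤ π/2`, the cone is an intersection of two half-planes, which coincide when `θ = π/2`.
Measurability, the interior and convexity all come from this form. -/
theorem mem_navCone_iff (hθ : 0 < θ) (hθ' : θ ≤ Real.pi / 2) {x : Plane} :
    x ∈ navCone θ ↔
      x ≠ 0 ∧ 0 ≤ inner ℝ (coneNormal θ 1) x ∧ 0 ≤ inner ℝ (coneNormal θ (-1)) x := by
  constructor
  · rintro ⟨r, φ, hr, hφ, rfl⟩
    rw [inner_coneNormal_one_polarPoint, inner_coneNormal_neg_one_polarPoint]
    rw [abs_le] at hφ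
    refine ⟨fun h => ?_, ?_, ?_⟩
    · have := norm_polarPoint hr.le φ
      rw [h, norm_zero] at this
      exact hr.ne this
    · exact mul_nonneg hr.le (Real.sin_nonneg_of_nonneg_of_le_pi (by linarith) (by linarith))
    · exact mul_nonneg hr.le (Real.sin_nonneg_of_nonneg_of_le_pi (by linarith) (by linarith))
  · rintro ⟨hx, h1, h2⟩
    obtain ⟨r, φ, hr, hφ1, hφ2, rfl⟩ := exists_polarPoint hx
    rw [inner_coneNormal_one_polarPoint] at h1
    rw [inner_coneNormal_neg_one_polarPoint] at h2
    refine ⟨r, φ, hr, abs_le.2 ⟨?_, ?_⟩, rfl⟩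
    · by_contra! hc
      have := Real.sin_neg_of_neg_of_neg_pi_lt (x := θ + φ) (by linarith) (by linarith)
      nlinarith
    · by_contra! hc
      have := Real.sin_neg_of_neg_of_neg_pi_lt (x := θ - φ) (by linarith) (by linarith)
      nlinarith

theorem measurableSet_navCone (hθ : 0 < θ) (hθ' : θ ≤ Real.pi / 2) :
    MeasurableSet (navCone θ) := by
  have : navCone θ = {0}ᶜ ∩ ({x | 0 ≤ inner ℝ (coneNormal θ 1) x} ∩
      {x | 0 ≤ inner ℝ (coneNormal θ (-1)) x}) := by
    ext x
    simp [mem_navCone_iff hθ hθ']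
  rw [this]
  refine (measurableSet_singleton _).compl.inter (IsClosed.measurableSet ?_)
  exact (isClosed_le continuous_const (by fun_prop)).inter
    (isClosed_le continuous_const (by fun_prop))

theorem zero_notMem_navCone (hθ : 0 < θ) (hθ' : θ ≤ Real.pi / 2) : (0 : Plane) ∉ navCone θ :=
  fun h => ((mem_navCone_iff hθ hθ').1 h).1 rfl

theorem coneNormal_ne_zero (hθ : 0 < θ) (hθ' : θ ≤ Real.pi / 2) (s : ℝ) :
    coneNormal θ s ≠ 0 := fun h =>
  (Real.sin_pos_of_pos_of_lt_pi hθ (by linarith [Real.pi_pos])).ne' <| by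
    simpa [coneNormal] using congrArg (fun x : Plane => x 0) h

theorem interior_navCone (hθ : 0 < θ) (hθ' : θ ≤ Real.pi / 2) :
    interior (navCone θ) =
      {x | 0 < inner ℝ (coneNormal θ 1) x ∧ 0 < inner ℝ (coneNormal θ (-1)) x} := by
  apply subset_antisymm
  · intro x hx
    -- A small step from an interior point against the normal stays in the cone, so the inner
    -- product was strictly positive before it.
    have key : ∀ s : ℝ, (∀ y ∈ navCone θ, 0 ≤ inner ℝ (coneNormal θ s) y) →
        0 < inner ℝ (coneNormal θ s) x := by
      intro s h
      have hc : Tendsto (fun t : ℝ => x - t • coneNormal θ s) (nhdsWithin 0 (Ioi 0))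
          (nhds x) := by
        have : Continuous (fun t : ℝ => x - t • coneNormal θ s) := by fun_prop
        have h0 := this.tendsto 0
        simp only [zero_smul, sub_zero] at h0
        exact h0.mono_left nhdsWithin_le_nhds
      obtain ⟨t, ht, ht0⟩ := ((hc.eventually (mem_interior_iff_mem_nhds.1 hx)).and
        self_mem_nhdsWithin).exists
      have h1 := h _ ht
      rw [inner_sub_right, inner_smul_right, real_inner_self_eq_norm_sq] at h1
      have hn : 0 < ‖coneNormal θ s‖ ^ 2 :=
        pow_pos (norm_pos_iff.2 (coneNormal_ne_zero hθ hθ' s)) 2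
      have : 0 < t * ‖coneNormal θ s‖ ^ 2 := mul_pos ht0 hn
      linarith
    exact ⟨key 1 fun y hy => ((mem_navCone_iff hθ hθ').1 hy).2.1,
      key (-1) fun y hy => ((mem_navCone_iff hθ hθ').1 hy).2.2⟩
  · refine interior_maximal ?_ ?_
    · rintro x ⟨h1, h2⟩
      refine (mem_navCone_iff hθ hθ').2 ⟨?_, h1.le, h2.le⟩
      rintro rfl
      simp at h1
    · have h (s : ℝ) : IsOpen {x : Plane | 0 < inner ℝ (coneNormal θ s) x} :=
        isOpen_lt continuous_const (by fun_prop)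
      exact (h 1).inter (h (-1))

theorem convex_interior_navCone (hθ : 0 < θ) (hθ' : θ ≤ Real.pi / 2) :
    Convex ℝ (interior (navCone θ)) := by
  rw [interior_navCone hθ hθ']
  refine Convex.inter ?_ ?_
  · exact convex_halfSpace_gt (f := fun x => inner ℝ (coneNormal θ 1) x)
      (innerₛₗ ℝ (coneNormal θ 1)).isLinear 0
  · exact convex_halfSpace_gt (f := fun x => inner ℝ (coneNormal θ (-1)) x)
      (innerₛₗ ℝ (coneNormal θ (-1))).isLinear 0

theorem lintegral_plane_polar (g : Plane → ENNReal) :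
    ∫⁻ x, g x = ∫⁻ p in polarCoord.target, ENNReal.ofReal p.1 * g (polarPoint p.1 p.2) := by
  have h1 := (PiLp.volume_preserving_toLp (Fin 2)).lintegral_comp_emb
    (MeasurableEquiv.toLp 2 (Fin 2 → ℝ)).measurableEmbedding g
  have h2 := (volume_preserving_finTwoArrow ℝ).symm.lintegral_comp_emb
    (MeasurableEquiv.finTwoArrow (α := ℝ)).symm.measurableEmbedding
    (fun y => g (WithLp.toLp 2 y))
  rw [← h1, ← h2, ← lintegral_comp_polarCoord_symm]
  rfl

theorem lintegral_navCone (hθ : 0 < θ) (hθ' : θ ≤ Real.pi / 2) {g : Plane → ENNReal}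
    (hg : Measurable g) :
    ∫⁻ x in navCone θ, g x = ∫⁻ r in Ioi (0 : ℝ), ENNReal.ofReal r *
      ∫⁻ φ in Icc (-θ) θ, g (polarPoint r φ) := by
  have hm : Measurable fun p : ℝ × ℝ => g (polarPoint p.1 p.2) := by
    refine hg.comp ?_
    unfold polarPoint
    fun_prop
  rw [← lintegral_indicator (measurableSet_navCone hθ hθ'), lintegral_plane_polar]
  have : ∫⁻ p in polarCoord.target, ENNReal.ofReal p.1 *
      (navCone θ).indicator g (polarPoint p.1 p.2) =
      ∫⁻ p in Ioi (0 : ℝ) ×ˢ Icc (-θ) θ, ENNReal.ofReal p.1 * g (polarPoint p.1 p.2) := by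
    rw [← lintegral_indicator polarCoord.open_target.measurableSet,
      ← lintegral_indicator (measurableSet_Ioi.prod measurableSet_Icc)]
    congr 1
    ext ⟨r, φ⟩
    simp only [polarCoord_target, indicator, mem_prod, mem_Ioi, mem_Ioo, mem_Icc]
    by_cases hr : 0 < r
    · by_cases hφ : -Real.pi < φ ∧ φ < Real.pi
      · simp only [hr, hφ, polarPoint_mem_navCone_iff hθ hθ' hr hφ.1 hφ.2.le, abs_le, and_self,
          if_true, true_and, mul_ite, mul_zero]
      · rw [if_neg (fun h => hφ h.2), if_neg]
        rintro ⟨-, h3, h4⟩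
        exact hφ ⟨by linarith [Real.pi_pos], by linarith [Real.pi_pos]⟩
    · simp [hr]
  rw [this, Measure.volume_eq_prod, ← Measure.prod_restrict, lintegral_prod]
  · congr 1
    ext r
    have hmr : Measurable fun φ => g (polarPoint r φ) := hm.comp measurable_prodMk_left
    dsimp only
    rw [lintegral_const_mul _ hmr]
  · exact ((by fun_prop : Measurable fun p : ℝ × ℝ => ENNReal.ofReal p.1).mul hm).aemeasurable

/-- The integral over the cone of a radial function. -/
theorem lintegral_navCone_radial (hθ : 0 < θ) (hθ' : θ ≤ Real.pi / 2) {g : ℝ → ENNReal}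
    (hg : Measurable g) :
    ∫⁻ x in navCone θ, g ‖x‖ =
      ENNReal.ofReal (2 * θ) * ∫⁻ r in Ioi (0 : ℝ), ENNReal.ofReal r * g r := by
  rw [lintegral_navCone hθ hθ' (g := fun x => g ‖x‖) (by fun_prop),
    ← lintegral_const_mul _ (by fun_prop)]
  refine setLIntegral_congr_fun measurableSet_Ioi fun r hr => ?_
  simp only [norm_polarPoint (le_of_lt hr), setLIntegral_const, Real.volume_Icc]
  rw [show θ - -θ = 2 * θ by ring]
  ring

/-- In the squared radius the area is linear, so annuli of equal width in `‖x‖²` have equal mass.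
This is why all later slicing is by `‖x‖²`. -/
theorem volume_navCone_inter_normSq_lt (hθ : 0 < θ) (hθ' : θ ≤ Real.pi / 2) {s : ℝ}
    (hs : 0 ≤ s) :
    volume (navCone θ ∩ {x | ‖x‖ ^ 2 < s}) = ENNReal.ofReal (θ * s) := by
  have hm : MeasurableSet {x : Plane | ‖x‖ ^ 2 < s} :=
    measurableSet_lt (by fun_prop) measurable_const
  have h1 : volume (navCone θ ∩ {x | ‖x‖ ^ 2 < s}) =
      ∫⁻ x in navCone θ, (Iio (√s)).indicator 1 ‖x‖ := by
    rw [inter_comm, ← Measure.restrict_apply hm, ← lintegral_indicator_one hm]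
    congr 1
    ext x
    simp [indicator, Real.lt_sqrt (norm_nonneg x)]
  rw [h1, lintegral_navCone_radial hθ hθ' (measurable_one.indicator measurableSet_Iio)]
  have h2 : ∫⁻ r in Ioi (0 : ℝ), ENNReal.ofReal r * (Iio (√s)).indicator 1 r =
      ENNReal.ofReal (s / 2) := by
    have : ∫⁻ r in Ioi (0 : ℝ), ENNReal.ofReal r * (Iio (√s)).indicator 1 r =
        ∫⁻ r in Ioo (0 : ℝ) (√s), ENNReal.ofReal r := by
      rw [← Ioi_inter_Iio, inter_comm, ← setLIntegral_indicator measurableSet_Iio]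
      congr 1
      ext r
      simp [indicator]
    rw [this, ← ofReal_integral_eq_lintegral_ofReal, ← integral_Ioc_eq_integral_Ioo,
      ← intervalIntegral.integral_of_le (Real.sqrt_nonneg s), integral_id]
    · rw [Real.sq_sqrt hs]; simp
    · exact (continuous_id.integrableOn_Icc (a := 0) (b := √s)).mono_set Ioo_subset_Icc_self
    · exact (ae_restrict_iff' measurableSet_Ioo).2 (ae_of_all _ fun r hr => hr.1.le)
  rw [h2, ← ENNReal.ofReal_mul (by positivity)]
  congr 1
  ring

end Cone

/-! ### Void probabilities and independence for Poisson processes. -/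

section Poisson

variable {Ω E : Type*} [MeasurableSpace Ω] [MeasurableSpace E] {P : Ω → Set E} {μ : Measure E}
  {Pr : Measure Ω}

theorem IsPoissonProcess.measure_encard_eq (hP : IsPoissonProcess P μ Pr) {B : Set E}
    (hB : MeasurableSet B) (hμB : μ B ≠ ⊤) (k : ℕ) :
    Pr {ω | (P ω ∩ B).encard = k} =
      ENNReal.ofReal (Real.exp (-(μ B).toReal) * (μ B).toReal ^ k / k.factorial) := by
  rw [(hP.hasLaw_count B hB hμB).measure_eq (p := fun n => n = (k : ℕ∞)) (.of_discrete),
    Measure.map_apply .of_discrete .of_discrete]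
  have : (fun k : ℕ => (k : ℕ∞)) ⁻¹' {x | x = (k : ℕ∞)} = {k} := by
    ext; simp
  rw [this, poissonMeasure_singleton]
  rfl

theorem IsPoissonProcess.measure_encard_eq_zero (hP : IsPoissonProcess P μ Pr) {B : Set E}
    (hB : MeasurableSet B) (hμB : μ B ≠ ⊤) :
    Pr {ω | (P ω ∩ B).encard = 0} = ENNReal.ofReal (Real.exp (-(μ B).toReal)) := by
  simpa using hP.measure_encard_eq hB hμB 0

theorem IsPoissonProcess.measure_encard_eq_one (hP : IsPoissonProcess P μ Pr) {B : Set E}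
    (hB : MeasurableSet B) (hμB : μ B ≠ ⊤) :
    Pr {ω | (P ω ∩ B).encard = 1} =
      ENNReal.ofReal (Real.exp (-(μ B).toReal) * (μ B).toReal) := by
  simpa using hP.measure_encard_eq hB hμB 1

theorem IsPoissonProcess.measure_encard_ne_zero_le [IsProbabilityMeasure Pr]
    (hP : IsPoissonProcess P μ Pr) {B : Set E} (hB : MeasurableSet B) (hμB : μ B ≠ ⊤) :
    Pr {ω | (P ω ∩ B).encard ≠ 0} ≤ μ B := by
  have hm : MeasurableSet {ω | (P ω ∩ B).encard = 0} :=
    hP.measurable_count B hB (measurableSet_singleton 0)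
  have h : {ω | (P ω ∩ B).encard ≠ 0} = {ω | (P ω ∩ B).encard = 0}ᶜ := rfl
  rw [h, prob_compl_eq_one_sub hm, hP.measure_encard_eq_zero hB hμB, ← ENNReal.ofReal_one,
    ← ENNReal.ofReal_sub _ (Real.exp_pos _).le]
  refine ENNReal.ofReal_le_of_le_toReal ?_
  linarith [Real.add_one_le_exp (-(μ B).toReal)]

theorem IsPoissonProcess.measure_and (hP : IsPoissonProcess P μ Pr) {B C : Set E}
    (hB : MeasurableSet B) (hC : MeasurableSet C) (hBC : Disjoint B C) (p q : ℕ∞ → Prop) :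
    Pr {ω | p (P ω ∩ B).encard ∧ q (P ω ∩ C).encard} =
      Pr {ω | p (P ω ∩ B).encard} * Pr {ω | q (P ω ∩ C).encard} := by
  have h := hP.iIndepFun_count 2 ![B, C] (by simp [Fin.forall_fin_two, hB, hC]) (by
    intro i j hij
    fin_cases i <;> fin_cases j <;> simp_all [disjoint_comm])
  have h01 := h.indepFun (i := 0) (j := 1) (by simp)
  exact h01.measure_inter_preimage_eq_mul {x | p x} {x | q x} .of_discrete .of_discrete

end Poisson

/-! ### The first step of the navigation on a fixed point set. -/

section Navigation

variable {θ : ℝ}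

theorem progress_one (θ : ℝ) (S : Set Plane) : progress θ S 1 = successor θ S 0 := by
  simp [progress, navigation]

/-- The default value of `successor` gives zero progress, and zero is outside the cone. So progress
inside the cone certifies a genuine nearest point. -/
theorem isNearestInCone_progress_one {S : Set Plane} (h : progress θ S 1 ≠ 0) :
    IsNearestInCone θ S 0 (progress θ S 1) := by
  rw [progress_one] at h ⊢
  unfold successor at h ⊢
  split_ifs at h ⊢ with h'
  · exact h'.choose_spec.1
  · exact absurd rfl h

theorem isNearestInCone_zero_iff {S : Set Plane} {w : Plane} :
    IsNearestInCone θ S 0 w ↔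
      (w ∈ S ∧ w ∈ navCone θ) ∧ ∀ x ∈ S, x ∈ navCone θ → ‖w‖ ≤ ‖x‖ := by
  simp [IsNearestInCone, navConeAt, and_imp]

theorem progress_one_mem_navCone {S : Set Plane} {a b : ℝ}
    (h0 : (S ∩ (navCone θ ∩ {x | ‖x‖ ^ 2 < a})).encard = 0)
    (h1 : (S ∩ (navCone θ ∩ {x | a ≤ ‖x‖ ^ 2 ∧ ‖x‖ ^ 2 < b})).encard = 1) :
    progress θ S 1 ∈ navCone θ := by
  obtain ⟨w, hw⟩ := encard_eq_one.1 h1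
  have hw' : w ∈ S ∩ (navCone θ ∩ {x | a ≤ ‖x‖ ^ 2 ∧ ‖x‖ ^ 2 < b}) := hw ▸ rfl
  rw [encard_eq_zero, eq_empty_iff_forall_notMem] at h0
  have hge : ∀ x ∈ S, x ∈ navCone θ → a ≤ ‖x‖ ^ 2 := fun x hx hxc => by
    by_contra! hlt
    exact h0 x ⟨hx, hxc, hlt⟩
  have huniq : ∀ x ∈ S, x ∈ navCone θ → ‖x‖ ^ 2 < b → x = w := fun x hx hxc hxb => by
    have : x ∈ S ∩ (navCone θ ∩ {x | a ≤ ‖x‖ ^ 2 ∧ ‖x‖ ^ 2 < b}) :=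
      ⟨hx, hxc, hge x hx hxc, hxb⟩
    rwa [hw] at this
  have hnear : IsNearestInCone θ S 0 w := by
    refine isNearestInCone_zero_iff.2 ⟨⟨hw'.1, hw'.2.1⟩, fun x hx hxc => ?_⟩
    rcases lt_or_ge (‖x‖ ^ 2) b with hxb | hxb
    · rw [huniq x hx hxc hxb]
    · exact (pow_le_pow_iff_left₀ (norm_nonneg _) (norm_nonneg _) two_ne_zero).1
        (hw'.2.2.2.le.trans hxb)
  have hex : ∃! w, IsNearestInCone θ S 0 w := by
    refine ⟨w, hnear, fun x hx => ?_⟩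
    replace hx := isNearestInCone_zero_iff.1 hx
    refine huniq x hx.1.1 hx.1.2 (lt_of_le_of_lt ?_ hw'.2.2.2)
    exact pow_le_pow_left₀ (norm_nonneg _) (hx.2 w hw'.1 hw'.2.1) 2
  rw [progress_one, successor, dif_pos hex]
  exact (isNearestInCone_zero_iff.1 hex.choose_spec.1).1.2

end Navigation

/-! ### The law of the first progress. -/

theorem integral_Ioi_mul_exp_neg_mul_sq {b : ℝ} (hb : 0 < b) :
    IntegrableOn (fun r : ℝ => r * Real.exp (-b * r ^ 2)) (Ioi 0) ∧
      ∫ r in Ioi (0 : ℝ), r * Real.exp (-b * r ^ 2) = (2 * b)⁻¹ := by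
  have hint := (integrable_mul_exp_neg_mul_sq hb).integrableOn (s := Ioi 0)
  refine ⟨hint, ?_⟩
  have hd : ∀ r ∈ Ici (0 : ℝ), HasDerivAt (fun r : ℝ => -(2 * b)⁻¹ * Real.exp (-b * r ^ 2))
      (r * Real.exp (-b * r ^ 2)) r := by
    intro r _
    have := (((hasDerivAt_pow 2 r).const_mul (-b)).exp).const_mul (-(2 * b)⁻¹)
    convert! this using 1
    field_simp
    ring
  have ht : Tendsto (fun r : ℝ => -(2 * b)⁻¹ * Real.exp (-b * r ^ 2)) atTop
      (nhds (-(2 * b)⁻¹ * 0)) := by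
    refine Tendsto.const_mul _ (Real.tendsto_exp_atBot.comp ?_)
    exact (tendsto_pow_atTop two_ne_zero).const_mul_atTop_of_neg (by linarith)
  rw [integral_Ioi_of_hasDerivAt_of_tendsto' hd hint ht]
  simp

theorem lintegral_Ioi_ofReal_mul_exp_neg_mul_sq {b : ℝ} (hb : 0 < b) :
    ∫⁻ r in Ioi (0 : ℝ), ENNReal.ofReal (r * Real.exp (-b * r ^ 2)) =
      ENNReal.ofReal (2 * b)⁻¹ := by
  rw [← (integral_Ioi_mul_exp_neg_mul_sq hb).2, ofReal_integral_eq_lintegral_ofReal]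
  · exact (integral_Ioi_mul_exp_neg_mul_sq hb).1
  · exact (ae_restrict_iff' measurableSet_Ioi).2
      (ae_of_all _ fun r hr => mul_nonneg (le_of_lt hr) (Real.exp_pos _).le)

/-- The density of the first progress variable on the cone. -/
noncomputable def progressDensity (lam θ : ℝ) (x : Plane) : ℝ :=
  lam * Real.exp (-lam * θ * ‖x‖ ^ 2)

/-- The law of the first progress variable. -/
noncomputable def progressLaw (lam θ : ℝ) : Measure Plane :=
  (volume.restrict (navCone θ)).withDensity fun x => ENNReal.ofReal (progressDensity lam θ x)

theorem measurable_progressDensity (lam θ : ℝ) : Measurable (progressDensity lam θ) := by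
  unfold progressDensity
  fun_prop

section Law

variable {lam θ : ℝ}

theorem progressLaw_univ (hlam : 0 < lam) (hθ : 0 < θ) (hθ' : θ ≤ Real.pi / 2) :
    progressLaw lam θ univ = 1 := by
  rw [progressLaw, withDensity_apply _ MeasurableSet.univ, Measure.restrict_univ]
  have h := lintegral_navCone_radial hθ hθ'
    (g := fun r => ENNReal.ofReal (lam * Real.exp (-lam * θ * r ^ 2))) (by fun_prop)
  have h2 : ∀ r ∈ Ioi (0 : ℝ), ENNReal.ofReal r *
      ENNReal.ofReal (lam * Real.exp (-lam * θ * r ^ 2)) =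
      ENNReal.ofReal lam * ENNReal.ofReal (r * Real.exp (-(lam * θ) * r ^ 2)) := by
    intro r hr
    rw [← ENNReal.ofReal_mul (le_of_lt hr), ← ENNReal.ofReal_mul hlam.le]
    congr 1
    ring_nf
  rw [setLIntegral_congr_fun measurableSet_Ioi h2, lintegral_const_mul _ (by fun_prop),
    lintegral_Ioi_ofReal_mul_exp_neg_mul_sq (mul_pos hlam hθ), ← ENNReal.ofReal_mul hlam.le,
    ← ENNReal.ofReal_mul (by positivity)] at h
  refine h.trans ?_
  rw [← ENNReal.ofReal_one]
  congr 1
  field_simp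

variable {Ω : Type*} [MeasurableSpace Ω] {Pr : Measure Ω} [IsProbabilityMeasure Pr]
  {P : Ω → Set Plane}

theorem measurableSet_navCone_inter_normSq_lt (hθ : 0 < θ) (hθ' : θ ≤ Real.pi / 2) (a : ℝ) :
    MeasurableSet (navCone θ ∩ {x | ‖x‖ ^ 2 < a}) :=
  (measurableSet_navCone hθ hθ').inter (measurableSet_lt (by fun_prop) measurable_const)

theorem measurableSet_navCone_inter_annulus (hθ : 0 < θ) (hθ' : θ ≤ Real.pi / 2) (a b : ℝ) :
    MeasurableSet (navCone θ ∩ {x | a ≤ ‖x‖ ^ 2 ∧ ‖x‖ ^ 2 < b}) :=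
  (measurableSet_navCone hθ hθ').inter
    ((by fun_prop : Measurable fun x : Plane => ‖x‖ ^ 2) measurableSet_Ico)

theorem smul_volume_navCone_inter_normSq_lt (hlam : 0 < lam) (hθ : 0 < θ)
    (hθ' : θ ≤ Real.pi / 2) {a : ℝ} (ha : 0 ≤ a) :
    (ENNReal.ofReal lam • (volume : Measure Plane)) (navCone θ ∩ {x | ‖x‖ ^ 2 < a}) =
      ENNReal.ofReal (lam * θ * a) := by
  rw [Measure.smul_apply, volume_navCone_inter_normSq_lt hθ hθ' ha, smul_eq_mul,
    ← ENNReal.ofReal_mul hlam.le, mul_assoc]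

theorem smul_volume_navCone_inter_annulus (hlam : 0 < lam) (hθ : 0 < θ)
    (hθ' : θ ≤ Real.pi / 2) {a b : ℝ} (ha : 0 ≤ a) (hab : a ≤ b) :
    (ENNReal.ofReal lam • (volume : Measure Plane))
      (navCone θ ∩ {x | a ≤ ‖x‖ ^ 2 ∧ ‖x‖ ^ 2 < b}) = ENNReal.ofReal (lam * θ * (b - a)) := by
  have h : navCone θ ∩ {x | a ≤ ‖x‖ ^ 2 ∧ ‖x‖ ^ 2 < b} =
      (navCone θ ∩ {x | ‖x‖ ^ 2 < b}) \ (navCone θ ∩ {x | ‖x‖ ^ 2 < a}) := by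
    ext x
    simp only [mem_inter_iff, mem_ofPred_eq, Set.mem_sdiff, not_and, not_lt]
    tauto
  have hfin := smul_volume_navCone_inter_normSq_lt hlam hθ hθ' ha
  rw [h, measure_sdiff _ (measurableSet_navCone_inter_normSq_lt hθ hθ' a).nullMeasurableSet
    (by rw [hfin]; exact ENNReal.ofReal_ne_top), hfin,
    smul_volume_navCone_inter_normSq_lt hlam hθ hθ' (ha.trans hab),
    ← ENNReal.ofReal_sub _ (by positivity), mul_sub]
  exact fun x hx => ⟨hx.1, lt_of_lt_of_le hx.2 hab⟩

/-- Landing in `A` forces the sector below `A` to be empty and `A` to be occupied. These are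
independent events, with probabilities `exp(-λθa)` and at most `λ|A|`. -/
theorem measure_progress_one_mem_le (hlam : 0 < lam) (hθ : 0 < θ) (hθ' : θ ≤ Real.pi / 2)
    (hP : IsPoissonProcess P (ENNReal.ofReal lam • (volume : Measure Plane)) Pr)
    {a b : ℝ} (ha : 0 ≤ a) (hab : a ≤ b) {A : Set Plane} (hA : MeasurableSet A)
    (hAs : A ⊆ navCone θ ∩ {x | a ≤ ‖x‖ ^ 2 ∧ ‖x‖ ^ 2 < b}) :
    Pr {ω | progress θ (P ω) 1 ∈ A} ≤
      ENNReal.ofReal (Real.exp (-(lam * θ * a))) * (ENNReal.ofReal lam * volume A) := by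
  have hB := measurableSet_navCone_inter_normSq_lt hθ hθ' a
  have hdisj : Disjoint (navCone θ ∩ {x | ‖x‖ ^ 2 < a}) A := by
    rw [Set.disjoint_left]
    exact fun x hx hxA => absurd hx.2 (not_lt.2 (hAs hxA).2.1)
  calc Pr {ω | progress θ (P ω) 1 ∈ A}
      ≤ Pr {ω | (P ω ∩ (navCone θ ∩ {x | ‖x‖ ^ 2 < a})).encard = 0 ∧
          (P ω ∩ A).encard ≠ 0} := by
        refine measure_mono fun ω hω => ?_
        have hω : progress θ (P ω) 1 ∈ A := hω
        have hne : progress θ (P ω) 1 ≠ 0 := fun h0 =>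
          zero_notMem_navCone hθ hθ' (h0 ▸ (hAs hω).1)
        have hn := isNearestInCone_zero_iff.1 (isNearestInCone_progress_one hne)
        constructor
        · rw [encard_eq_zero, eq_empty_iff_forall_notMem]
          rintro x ⟨hx, hxc, hxa⟩
          have h1 := pow_le_pow_left₀ (norm_nonneg _) (hn.2 x hx hxc) 2
          exact absurd ((hAs hω).2.1.trans h1) (not_le.2 hxa)
        · rw [encard_ne_zero]
          exact ⟨_, hn.1.1, hω⟩
    _ = _ := hP.measure_and hB hA hdisj (fun n => n = 0) (fun n => n ≠ 0)
    _ ≤ _ := by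
        have hμA : (ENNReal.ofReal lam • (volume : Measure Plane)) A ≠ ⊤ := by
          refine ne_top_of_le_ne_top ?_ (measure_mono hAs)
          rw [smul_volume_navCone_inter_annulus hlam hθ hθ' ha hab]
          exact ENNReal.ofReal_ne_top
        refine mul_le_mul' (le_of_eq ?_) (hP.measure_encard_ne_zero_le hA hμA)
        have h0 := smul_volume_navCone_inter_normSq_lt hlam hθ hθ' ha
        rw [hP.measure_encard_eq_zero hB (by rw [h0]; exact ENNReal.ofReal_ne_top), h0,
          ENNReal.toReal_ofReal (by positivity)]

theorem measure_progress_one_mem_annulus_le (hlam : 0 < lam) (hθ : 0 < θ)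
    (hθ' : θ ≤ Real.pi / 2)
    (hP : IsPoissonProcess P (ENNReal.ofReal lam • (volume : Measure Plane)) Pr)
    {a b : ℝ} (ha : 0 ≤ a) (hab : a ≤ b) {A : Set Plane} (hA : MeasurableSet A)
    (hAs : A ⊆ navCone θ ∩ {x | a ≤ ‖x‖ ^ 2 ∧ ‖x‖ ^ 2 < b}) :
    Pr {ω | progress θ (P ω) 1 ∈ A} ≤
      ENNReal.ofReal (Real.exp (lam * θ * (b - a))) *
        ∫⁻ x in A, ENNReal.ofReal (progressDensity lam θ x) := by
  refine (measure_progress_one_mem_le hlam hθ hθ' hP ha hab hA hAs).trans ?_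
  rw [← lintegral_const_mul _ (measurable_progressDensity lam θ).ennreal_ofReal, ← mul_assoc,
    ← ENNReal.ofReal_mul (Real.exp_pos _).le, ← setLIntegral_const]
  refine setLIntegral_mono_ae' hA (ae_of_all _ fun x hx => ?_)
  rw [← ENNReal.ofReal_mul (Real.exp_pos _).le, progressDensity, mul_left_comm, mul_comm _ lam,
    ← Real.exp_add]
  refine ENNReal.ofReal_le_ofReal (mul_le_mul_of_nonneg_left (Real.exp_le_exp.2 ?_) hlam.le)
  have h1 : 0 < lam * θ := mul_pos hlam hθ
  nlinarith [(hAs hx).2.2]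

/-- Cutting `A` into annuli of width `h` in `‖x‖²` costs the same factor `exp(λθh)` on each piece,
so the pieces add up. Letting `h → 0` then removes the factor. -/
theorem measure_progress_one_mem_le_exp_mul (hlam : 0 < lam) (hθ : 0 < θ)
    (hθ' : θ ≤ Real.pi / 2)
    (hP : IsPoissonProcess P (ENNReal.ofReal lam • (volume : Measure Plane)) Pr)
    {A : Set Plane} (hA : MeasurableSet A) (hAs : A ⊆ navCone θ) {h : ℝ} (hh : 0 < h) :
    Pr {ω | progress θ (P ω) 1 ∈ A} ≤
      ENNReal.ofReal (Real.exp (lam * θ * h)) *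
        ∫⁻ x in A, ENNReal.ofReal (progressDensity lam θ x) := by
  set B : ℕ → Set Plane := fun k => {x | ⌊‖x‖ ^ 2 / h⌋₊ = k} with hBdef
  have hBm : ∀ k, MeasurableSet (B k) := fun k =>
    (Nat.measurable_floor.comp (by fun_prop : Measurable fun x : Plane => ‖x‖ ^ 2 / h))
      (measurableSet_singleton k)
  have hB : ∀ k, B k ⊆ {x | k * h ≤ ‖x‖ ^ 2 ∧ ‖x‖ ^ 2 < (k + 1) * h} := by
    intro k x hx
    have := (Nat.floor_eq_iff (by positivity : 0 ≤ ‖x‖ ^ 2 / h)).1 hx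
    exact ⟨(le_div_iff₀ hh).1 this.1, (div_lt_iff₀ hh).1 this.2⟩
  have hU : A = ⋃ k, A ∩ B k := by
    ext x
    simp [hBdef]
  have hd : Pairwise (Function.onFun Disjoint fun k => A ∩ B k) := by
    intro i j hij
    refine Set.disjoint_left.2 fun x hx hx' => hij ?_
    exact hx.2.symm.trans hx'.2
  calc Pr {ω | progress θ (P ω) 1 ∈ A}
      ≤ ∑' k, Pr {ω | progress θ (P ω) 1 ∈ A ∩ B k} := by
        refine le_trans (measure_mono ?_) (measure_iUnion_le _)
        intro ω hω
        have : progress θ (P ω) 1 ∈ ⋃ k, A ∩ B k := hU ▸ hω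
        simpa using this
    _ ≤ ∑' k, ENNReal.ofReal (Real.exp (lam * θ * h)) *
          ∫⁻ x in A ∩ B k, ENNReal.ofReal (progressDensity lam θ x) := by
        refine ENNReal.tsum_le_tsum fun k => ?_
        have := measure_progress_one_mem_annulus_le hlam hθ hθ' hP (a := k * h)
          (b := (k + 1) * h) (by positivity) (by nlinarith) (hA.inter (hBm k))
          (fun x hx => ⟨hAs hx.1, hB k hx.2⟩)
        convert! this using 4
        ring
    _ = _ := by
        rw [ENNReal.tsum_mul_left, ← lintegral_iUnion (fun k => hA.inter (hBm k)) hd, ← hU]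

theorem measure_progress_one_mem_le_lintegral (hlam : 0 < lam) (hθ : 0 < θ)
    (hθ' : θ ≤ Real.pi / 2)
    (hP : IsPoissonProcess P (ENNReal.ofReal lam • (volume : Measure Plane)) Pr)
    {A : Set Plane} (hA : MeasurableSet A) (hAs : A ⊆ navCone θ) :
    Pr {ω | progress θ (P ω) 1 ∈ A} ≤ ∫⁻ x in A, ENNReal.ofReal (progressDensity lam θ x) := by
  have ht : Tendsto (fun h : ℝ => ENNReal.ofReal (Real.exp (lam * θ * h)) *
      ∫⁻ x in A, ENNReal.ofReal (progressDensity lam θ x)) (nhdsWithin 0 (Ioi 0))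
      (nhds (1 * ∫⁻ x in A, ENNReal.ofReal (progressDensity lam θ x))) := by
    refine ENNReal.Tendsto.mul_const ?_ (Or.inl one_ne_zero)
    have hc : Continuous fun h : ℝ => ENNReal.ofReal (Real.exp (lam * θ * h)) :=
      ENNReal.continuous_ofReal.comp (by fun_prop)
    have := hc.tendsto 0
    simp only [mul_zero, Real.exp_zero, ENNReal.ofReal_one] at this
    exact this.mono_left nhdsWithin_le_nhds
  rw [one_mul] at ht
  refine ge_of_tendsto ht ?_
  filter_upwards [self_mem_nhdsWithin] with h hh
  exact measure_progress_one_mem_le_exp_mul hlam hθ hθ' hP hA hAs hh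

omit [IsProbabilityMeasure Pr] in
-- If the first occupied annulus of width `h` in `‖x‖²` holds exactly one point, that point is the
-- unique minimiser. These events, indexed by the annulus, are disjoint and their probabilities form
-- a geometric series. As `h → 0` the bound tends to one, so ties and an empty cone are negligible.
theorem ofReal_exp_neg_le_measure_progress_one_mem_navCone (hlam : 0 < lam) (hθ : 0 < θ)
    (hθ' : θ ≤ Real.pi / 2)
    (hP : IsPoissonProcess P (ENNReal.ofReal lam • (volume : Measure Plane)) Pr)
    {h : ℝ} (hh : 0 < h) :
    ENNReal.ofReal (Real.exp (-(lam * θ * h))) ≤ Pr {ω | progress θ (P ω) 1 ∈ navCone θ} := by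
  set D : ℕ → Set Plane := fun k => navCone θ ∩ {x | ‖x‖ ^ 2 < k * h} with hD
  set R : ℕ → Set Plane := fun k =>
    navCone θ ∩ {x | k * h ≤ ‖x‖ ^ 2 ∧ ‖x‖ ^ 2 < (k + 1) * h} with hR
  have hDm : ∀ k, MeasurableSet (D k) := fun k => measurableSet_navCone_inter_normSq_lt hθ hθ' _
  have hRm : ∀ k, MeasurableSet (R k) := fun k => measurableSet_navCone_inter_annulus hθ hθ' _ _
  set F : ℕ → Set Ω := fun k => {ω | (P ω ∩ D k).encard = 0 ∧ (P ω ∩ R k).encard = 1} with hF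
  have hFm : ∀ k, MeasurableSet (F k) := fun k =>
    (hP.measurable_count _ (hDm k) (measurableSet_singleton 0)).inter
      (hP.measurable_count _ (hRm k) (measurableSet_singleton 1))
  have hFd : Pairwise (Function.onFun Disjoint F) := by
    refine (Std.Symm.pairwise_on (r := Disjoint) (f := F)).2 fun i j hij => ?_
    refine Set.disjoint_left.2 fun ω hi hj => ?_
    obtain ⟨w, hw⟩ := encard_eq_one.1 hi.2
    have hw' : w ∈ P ω ∩ R i := hw ▸ rfl
    have h0 := hj.1
    rw [encard_eq_zero, eq_empty_iff_forall_notMem] at h0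
    refine h0 w ⟨hw'.1, hw'.2.1, hw'.2.2.2.trans_le ?_⟩
    have : (i : ℝ) + 1 ≤ j := by exact_mod_cast hij
    exact mul_le_mul_of_nonneg_right this hh.le
  set x := lam * θ * h with hx
  have hx0 : 0 < x := by positivity
  have hprob : ∀ k, Pr (F k) = ENNReal.ofReal (Real.exp (-x) * x * Real.exp (-x) ^ k) := by
    intro k
    have hdisj : Disjoint (D k) (R k) :=
      Set.disjoint_left.2 fun y hy hy' => absurd hy.2 (not_lt.2 hy'.2.1)
    have hD0 := smul_volume_navCone_inter_normSq_lt hlam hθ hθ' (a := k * h) (by positivity)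
    have hR0 := smul_volume_navCone_inter_annulus hlam hθ hθ' (a := k * h) (b := (k + 1) * h)
      (by positivity) (by nlinarith)
    rw [hF, hP.measure_and (hDm k) (hRm k) hdisj (fun n => n = 0) (fun n => n = 1),
      hP.measure_encard_eq_zero (hDm k) (by rw [hD, hD0]; exact ENNReal.ofReal_ne_top),
      hP.measure_encard_eq_one (hRm k) (by rw [hR, hR0]; exact ENNReal.ofReal_ne_top),
      hD, hR, hD0, hR0, ENNReal.toReal_ofReal (by positivity),
      show lam * θ * ((k + 1) * h - k * h) = x by rw [hx]; ring,
      ENNReal.toReal_ofReal hx0.le, ← ENNReal.ofReal_mul (Real.exp_pos _).le, ← Real.exp_nat_mul]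
    congr 1
    rw [show -(lam * θ * (k * h)) = k * -x by rw [hx]; ring]
    ring
  have hq : Real.exp (-x) < 1 := by simpa using hx0
  have hgeo := (hasSum_geometric_of_lt_one (Real.exp_pos (-x)).le hq).mul_left
    (Real.exp (-x) * x)
  calc ENNReal.ofReal (Real.exp (-x))
      ≤ ENNReal.ofReal (Real.exp (-x) * x * (1 - Real.exp (-x))⁻¹) := by
        refine ENNReal.ofReal_le_ofReal ?_
        rw [← div_eq_mul_inv, le_div_iff₀ (by linarith)]
        -- The inequality `1 - exp(-x) ≤ x` bounds the sum of the series below by `exp(-x)`.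
        have := Real.add_one_le_exp (-x)
        exact mul_le_mul_of_nonneg_left (by linarith) (Real.exp_pos _).le
    _ = ∑' k, Pr (F k) := by
        simp_rw [hprob]
        rw [← hgeo.tsum_eq, ENNReal.ofReal_tsum_of_nonneg (fun k => by positivity) hgeo.summable]
    _ = Pr (⋃ k, F k) := (measure_iUnion hFd hFm).symm
    _ ≤ _ := by
        refine measure_mono (iUnion_subset fun k ω hω => ?_)
        exact progress_one_mem_navCone hω.1 hω.2

theorem measure_progress_one_mem_navCone (hlam : 0 < lam) (hθ : 0 < θ)
    (hθ' : θ ≤ Real.pi / 2)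
    (hP : IsPoissonProcess P (ENNReal.ofReal lam • (volume : Measure Plane)) Pr) :
    Pr {ω | progress θ (P ω) 1 ∈ navCone θ} = 1 := by
  refine le_antisymm prob_le_one ?_
  have ht : Tendsto (fun h : ℝ => ENNReal.ofReal (Real.exp (-(lam * θ * h))))
      (nhdsWithin 0 (Ioi 0)) (nhds 1) := by
    have hc : Continuous fun h : ℝ => ENNReal.ofReal (Real.exp (-(lam * θ * h))) :=
      ENNReal.continuous_ofReal.comp (by fun_prop)
    have := hc.tendsto 0
    simp only [mul_zero, neg_zero, Real.exp_zero, ENNReal.ofReal_one] at this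
    exact this.mono_left nhdsWithin_le_nhds
  refine le_of_tendsto ht ?_
  filter_upwards [self_mem_nhdsWithin] with h hh
  exact ofReal_exp_neg_le_measure_progress_one_mem_navCone hlam hθ hθ' hP hh

theorem map_progress_one (hlam : 0 < lam) (hθ : 0 < θ) (hθ' : θ ≤ Real.pi / 2)
    (hP : IsPoissonProcess P (ENNReal.ofReal lam • (volume : Measure Plane)) Pr)
    (hm : AEMeasurable (fun ω => progress θ (P ω) 1) Pr) :
    Pr.map (fun ω => progress θ (P ω) 1) = progressLaw lam θ := by
  have hc := measurableSet_navCone hθ hθ'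
  have : IsProbabilityMeasure (Pr.map (fun ω => progress θ (P ω) 1)) :=
    Measure.isProbabilityMeasure_map hm
  have hcone : Pr.map (fun ω => progress θ (P ω) 1) (navCone θ) = 1 := by
    rw [Measure.map_apply_of_aemeasurable hm hc]
    exact measure_progress_one_mem_navCone hlam hθ hθ' hP
  refine Measure.eq_of_le_of_measure_univ_eq (Measure.le_iff.2 fun A hA => ?_) ?_
  · have h1 : Pr.map (fun ω => progress θ (P ω) 1) A =
        Pr.map (fun ω => progress θ (P ω) 1) (A ∩ navCone θ) :=
      (measure_inter_conull ((prob_compl_eq_zero_iff hc).2 hcone)).symm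
    rw [h1, Measure.map_apply_of_aemeasurable hm (hA.inter hc), progressLaw,
      withDensity_apply _ hA, Measure.restrict_restrict hA]
    exact measure_progress_one_mem_le_lintegral hlam hθ hθ' hP (hA.inter hc) inter_subset_right
  · rw [progressLaw_univ hlam hθ hθ', measure_univ]

end Law

/-! ### Cramér's theorem in finite dimension. -/

section Cramer

open scoped RealInnerProductSpace

variable {E : Type*} [NormedAddCommGroup E] [InnerProductSpace ℝ E]

/-- A finite family of directions such that every vector makes a small angle with one of them. -/
theorem exists_finset_norm_le_two_mul_inner [FiniteDimensional ℝ E] :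
    ∃ T : Finset E, ∀ x : E, ∃ v ∈ T, ‖x‖ ≤ 2 * ⟪v, x⟫ := by
  classical
  have : ProperSpace E := FiniteDimensional.proper ℝ E
  obtain ⟨T, hT⟩ := (isCompact_sphere (0 : E) 1).elim_finite_subcover
    (fun v : E => {y : E | 1 / 2 < ⟪v, y⟫})
    (fun v => isOpen_lt continuous_const (by fun_prop)) (by
      intro y hy
      refine mem_iUnion.2 ⟨y, ?_⟩
      have : ‖y‖ = 1 := by simpa using hy
      simp only [mem_ofPred_eq, real_inner_self_eq_norm_sq, this]
      norm_num)
  refine ⟨insert 0 T, fun x => ?_⟩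
  rcases eq_or_ne x 0 with rfl | hx
  · exact ⟨0, by simp⟩
  have hx0 : 0 < ‖x‖ := norm_pos_iff.2 hx
  have hmem : ‖x‖⁻¹ • x ∈ Metric.sphere (0 : E) 1 := by
    simp [norm_smul, hx0.ne']
  obtain ⟨v, hv, hvx⟩ := mem_iUnion₂.1 (hT hmem)
  refine ⟨v, Finset.mem_insert_of_mem hv, ?_⟩
  simp only [mem_ofPred_eq, inner_smul_right] at hvx
  rw [inv_mul_eq_div, lt_div_iff₀ hx0] at hvx
  linarith

variable [MeasurableSpace E]

/-- The moment generating function of a measure on an inner product space. -/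
noncomputable def vectorMGF (μ : Measure E) (γ : E) : ℝ := ∫ x, Real.exp ⟪γ, x⟫ ∂μ

/-- The Legendre transform of the logarithmic moment generating function. -/
noncomputable def cramerRate (μ : Measure E) (u : E) : EReal :=
  ⨆ γ : E, ((⟪γ, u⟫ - Real.log (vectorMGF μ γ) : ℝ) : EReal)

theorem lowerSemicontinuous_cramerRate (μ : Measure E) : LowerSemicontinuous (cramerRate μ) := by
  refine lowerSemicontinuous_iSup fun γ => Continuous.lowerSemicontinuous ?_
  exact continuous_coe_real_ereal.comp (by fun_prop)

variable {μ : Measure E} [IsProbabilityMeasure μ]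

theorem cramerRate_nonneg (u : E) : 0 ≤ cramerRate μ u := by
  refine le_trans (le_of_eq ?_) (le_iSup _ (0 : E))
  simp [vectorMGF]

theorem vectorMGF_pos (hμ : ∀ γ : E, Integrable (fun x => Real.exp ⟪γ, x⟫) μ) (γ : E) :
    0 < vectorMGF μ γ := integral_exp_pos (hμ γ)

/-- Along the line, the function is a constant times the scalar `mgf` of `⟪v, x⟫` under the law
tilted by `γ`, which is finite everywhere. -/
theorem differentiableAt_vectorMGF_line [BorelSpace E]
    (hμ : ∀ γ : E, Integrable (fun x => Real.exp ⟪γ, x⟫) μ) (γ v : E) :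
    DifferentiableAt ℝ (fun t : ℝ => vectorMGF μ (γ + t • v)) 0 := by
  set ν := μ.tilted fun x => ⟪γ, x⟫ with hν
  have hint : ∀ t : ℝ, Integrable (fun x => Real.exp (t * ⟪v, x⟫)) ν := by
    intro t
    rw [hν, integrable_tilted_iff]
    convert! hμ (γ + t • v) using 2
    · simp [← Real.exp_add, inner_add_left, inner_smul_left]
    · exact hμ γ
  have hset : integrableExpSet (fun x => ⟪v, x⟫) ν = univ := eq_univ_of_forall hint
  have h := (hasDerivAt_mgf (X := fun x => ⟪v, x⟫) (μ := ν) (t := 0)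
    (by simp [hset])).differentiableAt.const_mul (vectorMGF μ γ)
  convert! h using 1
  ext t
  simp only [mgf, hν]
  rw [integral_exp_tilted]
  have h0 := (vectorMGF_pos hμ γ).ne'
  simp only [vectorMGF] at h0 ⊢
  rw [mul_div_assoc', mul_div_cancel_left₀ _ h0]
  congr 1
  ext x
  simp [inner_add_left, inner_smul_left]

variable {Ω : Type*} [MeasurableSpace Ω] {Pr : Measure Ω} [IsProbabilityMeasure Pr] {U : ℕ → Ω → E}

omit [IsProbabilityMeasure μ] [IsProbabilityMeasure Pr] in
theorem mgf_inner_eq [BorelSpace E] (hlaw : ∀ i, HasLaw (U i) μ Pr) (γ : E) (i : ℕ) :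
    mgf (fun ω => ⟪γ, U i ω⟫) Pr 1 = vectorMGF μ γ := by
  have hc : Continuous fun x : E => Real.exp ⟪γ, x⟫ := by fun_prop
  rw [vectorMGF, ← (hlaw i).map_eq, integral_map (hlaw i).aemeasurable
    hc.stronglyMeasurable.aestronglyMeasurable]
  simp [mgf]

section

variable [BorelSpace E] [SecondCountableTopology E]

omit [IsProbabilityMeasure μ] [IsProbabilityMeasure Pr] in
theorem integral_exp_inner_sum (hind : iIndepFun U Pr) (hlaw : ∀ i, HasLaw (U i) μ Pr)
    (γ : E) (n : ℕ) :
    ∫ ω, Real.exp ⟪γ, ∑ i ∈ Finset.range n, U i ω⟫ ∂Pr = vectorMGF μ γ ^ n := by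
  have hX : iIndepFun (fun i ω => ⟪γ, U i ω⟫) Pr :=
    hind.comp (fun _ x => ⟪γ, x⟫) fun _ => by fun_prop
  have h := hX.mgf_sum₀ (t := 1) (fun i => by
    have := (hlaw i).aemeasurable
    fun_prop) (Finset.range n)
  simp_rw [mgf_inner_eq hlaw, Finset.prod_const, Finset.card_range] at h
  rw [← h]
  simp [mgf, inner_sum]

theorem integrable_exp_inner_sum (hμ : ∀ γ : E, Integrable (fun x => Real.exp ⟪γ, x⟫) μ)
    (hind : iIndepFun U Pr) (hlaw : ∀ i, HasLaw (U i) μ Pr) (γ : E) (n : ℕ) :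
    Integrable (fun ω => Real.exp ⟪γ, ∑ i ∈ Finset.range n, U i ω⟫) Pr := by
  -- A non-integrable function has Bochner integral `0`, contradicting the positive value already
  -- computed.
  by_contra h
  have := integral_exp_inner_sum hind hlaw γ n
  rw [integral_undef h] at this
  exact (pow_pos (vectorMGF_pos hμ γ) n).ne this

theorem measureReal_le_inner_mean_le (hμ : ∀ γ : E, Integrable (fun x => Real.exp ⟪γ, x⟫) μ)
    (hind : iIndepFun U Pr) (hlaw : ∀ i, HasLaw (U i) μ Pr) (γ : E) (α : ℝ) {n : ℕ}
    (hn : 0 < n) :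
    Pr.real {ω | α ≤ ⟪γ, (n : ℝ)⁻¹ • ∑ i ∈ Finset.range n, U i ω⟫ -
      Real.log (vectorMGF μ γ)} ≤ Real.exp (-(n * α)) := by
  have hn' : (0 : ℝ) < n := by exact_mod_cast hn
  have h := measure_ge_le_exp_mul_mgf (μ := Pr) (t := 1)
    (X := fun ω => ⟪γ, ∑ i ∈ Finset.range n, U i ω⟫)
    (n * (α + Real.log (vectorMGF μ γ))) zero_le_one
    (by simpa using integrable_exp_inner_sum hμ hind hlaw γ n)
  have hset : {ω | α ≤ ⟪γ, (n : ℝ)⁻¹ • ∑ i ∈ Finset.range n, U i ω⟫ -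
      Real.log (vectorMGF μ γ)} = {ω | n * (α + Real.log (vectorMGF μ γ)) ≤
        ⟪γ, ∑ i ∈ Finset.range n, U i ω⟫} := by
    ext ω
    simp only [mem_ofPred_eq, inner_smul_right]
    rw [le_sub_iff_add_le, inv_mul_eq_div, le_div_iff₀ hn', mul_comm]
  rw [hset]
  refine h.trans (le_of_eq ?_)
  simp only [mgf, one_mul]
  rw [integral_exp_inner_sum hind hlaw, ← Real.exp_log (vectorMGF_pos hμ γ), Real.log_exp,
    ← Real.exp_nat_mul, ← Real.exp_add]
  congr 1
  ring

/-- Absorbs a constant prefactor into a slightly worse exponential rate. -/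
theorem eventually_const_mul_exp_le {C α β : ℝ} (h : β < α) :
    ∀ᶠ n : ℕ in atTop, C * Real.exp (-(n * α)) ≤ Real.exp (-(n * β)) := by
  have ht : Tendsto (fun n : ℕ => Real.exp ((n : ℝ) * (α - β))) atTop atTop :=
    Real.tendsto_exp_atTop.comp
      (tendsto_natCast_atTop_atTop.atTop_mul_const (sub_pos.2 h))
  filter_upwards [ht.eventually_ge_atTop C] with n hn
  calc C * Real.exp (-(n * α)) ≤ Real.exp (n * (α - β)) * Real.exp (-(n * α)) :=
        mul_le_mul_of_nonneg_right hn (Real.exp_pos _).le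
    _ = _ := by rw [← Real.exp_add]; congr 1; ring

variable [FiniteDimensional ℝ E]

omit [IsProbabilityMeasure μ] [BorelSpace E] [SecondCountableTopology E] in
-- Compactness handles the part of `F` in a ball. Outside it, the fixed directions `T` suffice
-- because `⟪v, x⟫ ≥ ‖x‖ / 2` for some `v ∈ T`. This replaces a separate exponential tightness
-- argument.
theorem exists_finset_forall_exists_lt (F : Set E) (hF : IsClosed F) {α : ℝ}
    (hα : (α : EReal) < ⨅ x ∈ F, cramerRate μ x) :
    ∃ Γ : Finset E, ∀ x ∈ F, ∃ γ ∈ Γ, α ≤ ⟪γ, x⟫ - Real.log (vectorMGF μ γ) := by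
  classical
  have : ProperSpace E := FiniteDimensional.proper ℝ E
  obtain ⟨T, hT⟩ := exists_finset_norm_le_two_mul_inner (E := E)
  -- `R` is chosen so that `‖x‖ / 2 > α + log (vectorMGF μ v)` for all `v ∈ T` once `‖x‖ > R`.
  obtain ⟨R, hR⟩ := (T.image fun v => 2 * (α + Real.log (vectorMGF μ v))).bddAbove
  obtain ⟨Γ, hΓ⟩ := ((isCompact_closedBall (0 : E) R).inter_left hF).elim_finite_subcover
    (fun γ : E => {x : E | α < ⟪γ, x⟫ - Real.log (vectorMGF μ γ)})
    (fun γ => isOpen_lt continuous_const (by fun_prop)) (by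
      rintro x ⟨hx, -⟩
      have h1 : (α : EReal) < cramerRate μ x := hα.trans_le (iInf₂_le x hx)
      obtain ⟨γ, hγ⟩ := lt_iSup_iff.1 h1
      exact mem_iUnion.2 ⟨γ, EReal.coe_lt_coe_iff.1 hγ⟩)
  refine ⟨T ∪ Γ, fun x hx => ?_⟩
  rcases le_or_gt ‖x‖ R with hxR | hxR
  · obtain ⟨γ, hγ, hγx⟩ := mem_iUnion₂.1 (hΓ ⟨hx, by simpa using hxR⟩)
    exact ⟨γ, Finset.mem_union_right _ hγ, le_of_lt hγx⟩
  · obtain ⟨v, hv, hvx⟩ := hT x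
    have h2 := hR (Finset.mem_coe.2 (Finset.mem_image_of_mem _ hv))
    exact ⟨v, Finset.mem_union_left _ hv, by linarith⟩

theorem eventually_measureReal_mean_le (hμ : ∀ γ : E, Integrable (fun x => Real.exp ⟪γ, x⟫) μ)
    (hind : iIndepFun U Pr) (hlaw : ∀ i, HasLaw (U i) μ Pr) {F : Set E} (hF : IsClosed F) {β : ℝ}
    (hβ : (β : EReal) < ⨅ x ∈ F, cramerRate μ x) :
    ∀ᶠ n : ℕ in atTop, Pr.real ((fun ω => (n : ℝ)⁻¹ • ∑ i ∈ Finset.range n, U i ω) ⁻¹' F) ≤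
      Real.exp (-(n * β)) := by
  obtain ⟨α, hβα, hα⟩ := EReal.lt_iff_exists_real_btwn.1 hβ
  obtain ⟨Γ, hΓ⟩ := exists_finset_forall_exists_lt F hF hα
  filter_upwards [eventually_const_mul_exp_le (C := Γ.card) (EReal.coe_lt_coe_iff.1 hβα),
    eventually_gt_atTop 0] with n hn hn0
  refine le_trans ?_ hn
  calc _ ≤ Pr.real (⋃ γ ∈ Γ, {ω | α ≤ ⟪γ, (n : ℝ)⁻¹ • ∑ i ∈ Finset.range n, U i ω⟫ -
        Real.log (vectorMGF μ γ)}) := by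
        refine measureReal_mono (fun ω hω => ?_) (measure_ne_top _ _)
        obtain ⟨γ, hγ, h⟩ := hΓ _ hω
        exact mem_iUnion₂.2 ⟨γ, hγ, h⟩
    _ ≤ ∑ γ ∈ Γ, Real.exp (-(n * α)) :=
        (measureReal_biUnion_finset_le _ _).trans
          (Finset.sum_le_sum fun γ _ => measureReal_le_inner_mean_le hμ hind hlaw γ α hn0)
    _ = _ := by simp

omit [IsProbabilityMeasure Pr] [SecondCountableTopology E] [FiniteDimensional ℝ E] in
/-- At a minimiser `γ` of `γ ↦ E exp ⟪γ, X - u⟫`, exponential tails around `u` are strictly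
smaller than the minimum. -/
theorem exists_exp_tail_lt (hμ : ∀ γ : E, Integrable (fun x => Real.exp ⟪γ, x⟫) μ) {u γ : E}
    (hγ : ∀ γ', Real.exp (-⟪γ, u⟫) * vectorMGF μ γ ≤ Real.exp (-⟪γ', u⟫) * vectorMGF μ γ')
    {δ : ℝ} (hδ : 0 < δ) (v : E) :
    ∃ t : ℝ, 0 < t ∧ Real.exp (-⟪γ + t • v, u⟫) * vectorMGF μ (γ + t • v) *
      Real.exp (-(t * δ)) < Real.exp (-⟪γ, u⟫) * vectorMGF μ γ := by
  set φ : ℝ → ℝ := fun t => Real.exp (-⟪γ + t • v, u⟫) * vectorMGF μ (γ + t • v) with hφ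
  have hφ0 : φ 0 = Real.exp (-⟪γ, u⟫) * vectorMGF μ γ := by simp [hφ]
  have hpos : 0 < φ 0 := hφ0 ▸ mul_pos (Real.exp_pos _) (vectorMGF_pos hμ γ)
  have hdiff : DifferentiableAt ℝ φ 0 := by
    refine DifferentiableAt.mul ?_ (differentiableAt_vectorMGF_line hμ γ v)
    have : (fun t : ℝ => Real.exp (-⟪γ + t • v, u⟫)) =
        fun t => Real.exp (-(⟪γ, u⟫ + t * ⟪v, u⟫)) := by
      ext t; simp [inner_add_left, inner_smul_left]
    rw [this]
    fun_prop
  -- Minimality kills the derivative of `φ`, so the product with `exp(-tδ)` has derivative `-δ φ(0)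
  -- < 0` at zero.
  have hmin : IsLocalMin φ 0 := Eventually.of_forall fun t => by
    rw [hφ0]; exact hγ _
  have h0 : HasDerivAt φ 0 0 := by
    simpa only [hmin.deriv_eq_zero] using hdiff.hasDerivAt
  have he : HasDerivAt (fun t : ℝ => Real.exp (-(t * δ))) (-δ) 0 := by
    have := (((hasDerivAt_id (0 : ℝ)).mul_const δ).neg).exp
    simpa using this
  have hg := h0.mul he
  have hs := hg.tendsto_slope_zero_right
  simp only [zero_mul, zero_add, neg_zero, Real.exp_zero, mul_one, Pi.mul_apply] at hs
  have hneg : φ 0 * -δ < 0 := by nlinarith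
  obtain ⟨t, ht, ht0⟩ := ((hs.eventually_lt_const hneg).and self_mem_nhdsWithin).exists
  have ht0 : 0 < t := ht0
  refine ⟨t, ht0, ?_⟩
  rw [← hφ0]
  rw [smul_eq_mul, inv_mul_eq_div, div_lt_iff₀ ht0, zero_mul] at ht
  exact sub_neg.1 ht

/-- Split `E exp⟪γ, S_n⟫` according to whether the mean lies in the ball. Off the ball some `v ∈ T`
satisfies `⟪v, S_n/n - u⟫ ≥ δ/2`, and a further tilt along `v` bounds that part, after
normalisation, by `q v ^ n` with `q v < m`. The finite sum of these is eventually below `m ^ n / 2`.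
No change of measure or law of large numbers is needed. -/
theorem eventually_le_measureReal_mean_ball
    (hμ : ∀ γ : E, Integrable (fun x => Real.exp ⟪γ, x⟫) μ)
    (hind : iIndepFun U Pr) (hlaw : ∀ i, HasLaw (U i) μ Pr) {u γ : E}
    (hγ : ∀ γ', Real.exp (-⟪γ, u⟫) * vectorMGF μ γ ≤ Real.exp (-⟪γ', u⟫) * vectorMGF μ γ')
    {δ : ℝ} (hδ : 0 < δ) :
    ∀ᶠ n : ℕ in atTop, (Real.exp (-⟪γ, u⟫) * vectorMGF μ γ) ^ n / 2 ≤ Real.exp (n * (‖γ‖ * δ)) *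
      Pr.real ((fun ω => (n : ℝ)⁻¹ • ∑ i ∈ Finset.range n, U i ω) ⁻¹' Metric.ball u δ) := by
  obtain ⟨T, hT⟩ := exists_finset_norm_le_two_mul_inner (E := E)
  choose t ht0 ht using exists_exp_tail_lt hμ hγ (half_pos hδ)
  set m := Real.exp (-⟪γ, u⟫) * vectorMGF μ γ with hm
  have hm0 : 0 < m := mul_pos (Real.exp_pos _) (vectorMGF_pos hμ γ)
  set q : E → ℝ := fun v => Real.exp (-⟪γ + t v • v, u⟫) * vectorMGF μ (γ + t v • v) *
      Real.exp (-(t v * (δ / 2))) with hq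
  have hq0 : ∀ v, 0 ≤ q v := fun v =>
    (mul_pos (mul_pos (Real.exp_pos _) (vectorMGF_pos hμ _)) (Real.exp_pos _)).le
  have hlim : Tendsto (fun n : ℕ => ∑ v ∈ T, (q v / m) ^ n) atTop (nhds (∑ v ∈ T, 0)) :=
    tendsto_finsetSum _ fun v _ => tendsto_pow_atTop_nhds_zero_of_lt_one
      (div_nonneg (hq0 v) hm0.le) ((div_lt_one hm0).2 (ht v))
  rw [Finset.sum_const_zero] at hlim
  filter_upwards [hlim.eventually_lt_const (by norm_num : (0 : ℝ) < 1 / 2),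
    eventually_gt_atTop 0] with n hn hn0
  have hn' : (0 : ℝ) < n := by exact_mod_cast hn0
  set S : Ω → E := fun ω => ∑ i ∈ Finset.range n, U i ω with hS
  have hSm : AEMeasurable S Pr :=
    Finset.aemeasurable_fun_sum _ fun i _ => (hlaw i).aemeasurable
  set A : Set Ω := (fun ω => (n : ℝ)⁻¹ • S ω) ⁻¹' Metric.ball u δ with hA
  have hAm : NullMeasurableSet A Pr :=
    (hSm.const_smul (n : ℝ)⁻¹).nullMeasurable measurableSet_ball
  -- Chosen so that `c v * exp⟪γ + t v • v, S⟫` dominates `exp⟪γ, S⟫` exactly where `⟪v, S/n - u⟫ ≥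
  -- δ/2`.
  set c : E → ℝ := fun v => Real.exp (-(n * ⟪γ + t v • v, u⟫) +
    n * ⟪γ, u⟫ - n * (t v * (δ / 2))) with hc
  have hpt : ∀ ω, Real.exp ⟪γ, S ω⟫ ≤
      A.indicator (fun _ => Real.exp (n * (⟪γ, u⟫ + ‖γ‖ * δ))) ω +
        ∑ v ∈ T, c v * Real.exp ⟪γ + t v • v, S ω⟫ := by
    intro ω
    have hsum : ∀ v, 0 ≤ c v * Real.exp ⟪γ + t v • v, S ω⟫ := fun v =>
      mul_nonneg (Real.exp_pos _).le (Real.exp_pos _).le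
    obtain ⟨z, hz⟩ : ∃ z : E, (n : ℝ)⁻¹ • S ω = z := ⟨_, rfl⟩
    have hSn : S ω = (n : ℝ) • z := by
      rw [← hz, smul_smul, mul_inv_cancel₀ hn'.ne', one_smul]
    have hzA : ω ∈ A ↔ ‖z - u‖ < δ := by
      rw [← hz]
      exact mem_ball_iff_norm
    by_cases hω : ω ∈ A
    · rw [indicator_of_mem hω]
      refine le_trans ?_ (le_add_of_nonneg_right (Finset.sum_nonneg fun v _ => hsum v))
      refine Real.exp_le_exp.2 ?_
      rw [hSn, inner_smul_right]
      refine mul_le_mul_of_nonneg_left ?_ hn'.le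
      have h1 : ⟪γ, z - u⟫ ≤ ‖γ‖ * ‖z - u‖ := real_inner_le_norm _ _
      have h2 : ‖z - u‖ ≤ δ := (hzA.1 hω).le
      rw [inner_sub_right] at h1
      nlinarith [norm_nonneg γ]
    · rw [indicator_of_notMem hω, zero_add]
      obtain ⟨v, hv, hvx⟩ := hT (z - u)
      refine le_trans ?_ (Finset.single_le_sum (fun v _ => hsum v) hv)
      rw [hc, ← Real.exp_add]
      refine Real.exp_le_exp.2 ?_
      have h2 : δ ≤ ‖z - u‖ := by
        by_contra! h
        exact hω (hzA.2 h)
      rw [hSn, inner_smul_right, inner_smul_right, inner_add_left, inner_add_left,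
        inner_smul_left, inner_smul_left]
      rw [inner_sub_right] at hvx
      have h3 : 0 ≤ n * (t v * (⟪v, z⟫ - ⟪v, u⟫ - δ / 2)) :=
        mul_nonneg hn'.le (mul_nonneg (ht0 v).le (by linarith))
      simp only [conj_trivial]
      linarith
  have hint : ∀ v, Integrable (fun ω => c v * Real.exp ⟪γ + t v • v, S ω⟫) Pr := fun v =>
    (integrable_exp_inner_sum hμ hind hlaw _ n).const_mul _
  have hmain := integral_mono (integrable_exp_inner_sum hμ hind hlaw γ n)
    (((integrable_const _).indicator₀ hAm).add (integrable_finsetSum T fun v _ => hint v)) hpt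
  simp only [Pi.add_apply] at hmain
  rw [integral_add ((integrable_const _).indicator₀ hAm)
    (integrable_finsetSum T fun v _ => hint v), integral_indicator₀ hAm, setIntegral_const,
    integral_finsetSum T fun v _ => hint v, integral_exp_inner_sum hind hlaw] at hmain
  simp_rw [integral_const_mul] at hmain
  simp_rw [hS, integral_exp_inner_sum hind hlaw] at hmain
  have hcm : ∀ v, c v * vectorMGF μ (γ + t v • v) ^ n = Real.exp (n * ⟪γ, u⟫) * q v ^ n := by
    intro v
    simp only [hq, hc]
    rw [mul_pow, mul_pow, ← Real.exp_nat_mul, ← Real.exp_nat_mul,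
      show -(n * ⟪γ + t v • v, u⟫) + n * ⟪γ, u⟫ - n * (t v * (δ / 2)) =
        n * ⟪γ, u⟫ + (n * -⟪γ + t v • v, u⟫ + n * -(t v * (δ / 2))) by ring,
      Real.exp_add, Real.exp_add (n * -⟪γ + t v • v, u⟫)]
    ring
  simp_rw [hcm, ← Finset.mul_sum, smul_eq_mul] at hmain
  have hmn : m ^ n = Real.exp (-(n * ⟪γ, u⟫)) * vectorMGF μ γ ^ n := by
    rw [hm, mul_pow, ← Real.exp_nat_mul, mul_neg]
  have hsumq : ∑ v ∈ T, q v ^ n ≤ m ^ n / 2 := by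
    simp_rw [div_pow] at hn
    rw [← Finset.sum_div, div_lt_iff₀ (pow_pos hm0 n)] at hn
    linarith
  have h5 := mul_le_mul_of_nonneg_left hmain (Real.exp_pos (-(n * ⟪γ, u⟫))).le
  rw [← hmn, mul_add, mul_left_comm, ← Real.exp_add, ← mul_assoc (Real.exp _) (Real.exp _),
    ← Real.exp_add, neg_add_cancel, Real.exp_zero, one_mul,
    show -(n * ⟪γ, u⟫) + n * (⟪γ, u⟫ + ‖γ‖ * δ) = n * (‖γ‖ * δ) by ring] at h5
  linarith

theorem eventually_le_measureReal_mean
    (hμ : ∀ γ : E, Integrable (fun x => Real.exp ⟪γ, x⟫) μ)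
    (hind : iIndepFun U Pr) (hlaw : ∀ i, HasLaw (U i) μ Pr) {u γ : E}
    (hγ : ∀ γ', Real.exp (-⟪γ, u⟫) * vectorMGF μ γ ≤ Real.exp (-⟪γ', u⟫) * vectorMGF μ γ')
    {G : Set E} (hG : IsOpen G) (hu : u ∈ G) {b : ℝ} (hb : cramerRate μ u < b) :
    ∀ᶠ n : ℕ in atTop, Real.exp (-(n * b)) ≤
      Pr.real ((fun ω => (n : ℝ)⁻¹ • ∑ i ∈ Finset.range n, U i ω) ⁻¹' G) := by
  set a := ⟪γ, u⟫ - Real.log (vectorMGF μ γ) with ha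
  have hab : a < b := EReal.coe_lt_coe_iff.1
    ((le_iSup (fun γ => ((⟪γ, u⟫ - Real.log (vectorMGF μ γ) : ℝ) : EReal)) γ).trans_lt hb)
  have hm : Real.exp (-⟪γ, u⟫) * vectorMGF μ γ = Real.exp (-a) := by
    nth_rewrite 1 [← Real.exp_log (vectorMGF_pos hμ γ)]
    rw [← Real.exp_add, ha]
    congr 1
    ring
  obtain ⟨ε, hε, hεG⟩ := Metric.isOpen_iff.1 hG u hu
  -- The ball must fit in `G` and its cost `‖γ‖ * δ` in the gap `b - a`. The denominator `‖γ‖ + 1`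
  -- covers `γ = 0`.
  obtain ⟨δ, hδ, hδε, hδb⟩ : ∃ δ : ℝ, 0 < δ ∧ δ ≤ ε ∧ a + ‖γ‖ * δ < b := by
    have hpos : 0 < ‖γ‖ + 1 := by positivity
    refine ⟨min ε ((b - a) / (‖γ‖ + 1) / 2), lt_min hε (by
      have := sub_pos.2 hab; positivity), min_le_left _ _, ?_⟩
    have h1 : ‖γ‖ * min ε ((b - a) / (‖γ‖ + 1) / 2) ≤
        (‖γ‖ + 1) * ((b - a) / (‖γ‖ + 1) / 2) := by
      refine mul_le_mul (by linarith) (min_le_right _ _) ?_ hpos.le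
      have := sub_pos.2 hab
      positivity
    have h2 : (‖γ‖ + 1) * ((b - a) / (‖γ‖ + 1) / 2) = (b - a) / 2 := by field_simp
    linarith
  filter_upwards [eventually_le_measureReal_mean_ball hμ hind hlaw hγ hδ,
    eventually_const_mul_exp_le (C := 2) hδb] with n h1 h2
  rw [hm, ← Real.exp_nat_mul] at h1
  have h3 : Pr.real ((fun ω => (n : ℝ)⁻¹ • ∑ i ∈ Finset.range n, U i ω) ⁻¹' Metric.ball u δ) ≤
      Pr.real ((fun ω => (n : ℝ)⁻¹ • ∑ i ∈ Finset.range n, U i ω) ⁻¹' G) :=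
    measureReal_mono (preimage_mono ((Metric.ball_subset_ball hδε).trans hεG))
  refine le_trans ?_ h3
  have h4 : Real.exp (-(n * b)) ≤ Real.exp (-(n * (a + ‖γ‖ * δ))) / 2 := by linarith
  have h5 := mul_le_mul_of_nonneg_left h1 (Real.exp_pos (-(n * (‖γ‖ * δ)))).le
  rw [← mul_assoc (Real.exp _) (Real.exp _), ← Real.exp_add, neg_add_cancel, Real.exp_zero,
    one_mul, mul_div_assoc',
    ← Real.exp_add, show -(n * (‖γ‖ * δ)) + n * -a = -(n * (a + ‖γ‖ * δ)) by ring] at h5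
  exact h4.trans h5

/-- **Cramér's theorem** in a finite-dimensional inner product space, for a law with everywhere
finite moment generating function such that `γ ↦ E exp ⟪γ, X - u⟫` attains its minimum whenever
the rate of `u` is finite. -/
theorem satisfiesLDP_cramerRate
    (hμ : ∀ γ : E, Integrable (fun x => Real.exp ⟪γ, x⟫) μ)
    (hmin : ∀ u, cramerRate μ u < ⊤ → ∃ γ, ∀ γ', Real.exp (-⟪γ, u⟫) * vectorMGF μ γ ≤
      Real.exp (-⟪γ', u⟫) * vectorMGF μ γ')
    (hind : iIndepFun U Pr) (hlaw : ∀ i, HasLaw (U i) μ Pr) :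
    SatisfiesLDP Pr (fun n ω => (n : ℝ)⁻¹ • ∑ i ∈ Finset.range n, U i ω) (fun n => (n : ℝ))
      (cramerRate μ) where
  nonneg := cramerRate_nonneg
  lowerSemicontinuous := lowerSemicontinuous_cramerRate μ
  upper_bound F hF := by
    rw [EReal.le_neg]
    refine EReal.ge_of_forall_gt_iff_ge.1 fun β hβ => ?_
    rw [EReal.le_neg]
    refine limsup_le_of_le (by isBoundedDefault) ?_
    filter_upwards [eventually_measureReal_mean_le hμ hind hlaw hF hβ,
      eventually_gt_atTop 0] with n hn hn0
    have hn' : (0 : ℝ) < n := by exact_mod_cast hn0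
    calc _ ≤ ENNReal.log (ENNReal.ofReal (Real.exp (-(n * β)))) / ((n : ℝ) : EReal) := by
          refine EReal.div_le_div_right_of_nonneg (EReal.coe_nonneg.2 hn'.le)
            (ENNReal.log_le_log ?_)
          rw [← ofReal_measureReal]
          exact ENNReal.ofReal_le_ofReal hn
      _ = _ := by
          rw [ENNReal.log_ofReal_of_pos (Real.exp_pos _), Real.log_exp, ← EReal.coe_div,
            ← EReal.coe_neg]
          congr 1
          field_simp
  lower_bound G hG := by
    rw [EReal.neg_le]
    refine le_iInf₂ fun u hu => ?_
    refine EReal.le_of_forall_lt_iff_le.1 fun b hb => ?_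
    obtain ⟨γ, hγ⟩ := hmin u (hb.trans (EReal.coe_lt_top b))
    rw [EReal.neg_le]
    refine le_liminf_of_le (by isBoundedDefault) ?_
    filter_upwards [eventually_le_measureReal_mean hμ hind hlaw hγ hG hu hb,
      eventually_gt_atTop 0] with n hn hn0
    have hn' : (0 : ℝ) < n := by exact_mod_cast hn0
    calc _ = ENNReal.log (ENNReal.ofReal (Real.exp (-(n * b)))) / ((n : ℝ) : EReal) := by
          rw [ENNReal.log_ofReal_of_pos (Real.exp_pos _), Real.log_exp, ← EReal.coe_div,
            ← EReal.coe_neg]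
          congr 1
          field_simp
      _ ≤ _ := by
          refine EReal.div_le_div_right_of_nonneg (EReal.coe_nonneg.2 hn'.le)
            (ENNReal.log_le_log ?_)
          rw [← ofReal_measureReal]
          exact ENNReal.ofReal_le_ofReal hn

end

end Cramer

/-! ### Finiteness, convexity and continuity of the rate. -/

section CramerRate

open scoped RealInnerProductSpace

variable {E : Type*} [NormedAddCommGroup E] [InnerProductSpace ℝ E] [MeasurableSpace E]
  {μ : Measure E} [IsProbabilityMeasure μ]

omit [IsProbabilityMeasure μ] in
theorem convexOn_vectorMGF (hμ : ∀ γ : E, Integrable (fun x => Real.exp ⟪γ, x⟫) μ) :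
    ConvexOn ℝ univ (vectorMGF μ) := by
  refine ⟨convex_univ, fun γ _ γ' _ a b ha hb hab => ?_⟩
  simp only [vectorMGF, smul_eq_mul]
  rw [← integral_const_mul, ← integral_const_mul, ← integral_add ((hμ γ).const_mul a)
    ((hμ γ').const_mul b)]
  refine integral_mono (hμ _) (((hμ γ).const_mul a).add ((hμ γ').const_mul b)) fun x => ?_
  have := convexOn_exp.2 (mem_univ ⟪γ, x⟫) (mem_univ ⟪γ', x⟫) ha hb hab
  simpa [inner_add_left, inner_smul_left] using this

omit [IsProbabilityMeasure μ] in
theorem continuous_vectorMGF [FiniteDimensional ℝ E]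
    (hμ : ∀ γ : E, Integrable (fun x => Real.exp ⟪γ, x⟫) μ) : Continuous (vectorMGF μ) :=
  continuousOn_univ.1 ((convexOn_vectorMGF hμ).continuousOn isOpen_univ)

theorem coe_toReal_cramerRate {u : E} (hu : cramerRate μ u < ⊤) :
    ((cramerRate μ u).toReal : EReal) = cramerRate μ u :=
  EReal.coe_toReal hu.ne (ne_bot_of_le_ne_bot EReal.zero_ne_bot (cramerRate_nonneg u))

theorem sub_log_vectorMGF_le_toReal {u : E} (hu : cramerRate μ u < ⊤) (γ : E) :
    ⟪γ, u⟫ - Real.log (vectorMGF μ γ) ≤ (cramerRate μ u).toReal := by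
  rw [← EReal.coe_le_coe_iff, coe_toReal_cramerRate hu]
  exact le_iSup (fun γ => ((⟪γ, u⟫ - Real.log (vectorMGF μ γ) : ℝ) : EReal)) γ

/-- A supremum of affine functions of `u` is convex. Passing to `toReal` makes the real-valued
continuity theorem for convex functions available. -/
theorem convexOn_toReal_cramerRate {C : Set E} (hC : Convex ℝ C)
    (hfin : ∀ u ∈ C, cramerRate μ u < ⊤) :
    ConvexOn ℝ C fun u => (cramerRate μ u).toReal := by
  refine ⟨hC, fun x hx y hy a b ha hb hab => ?_⟩
  rw [← EReal.coe_le_coe_iff, coe_toReal_cramerRate (hfin _ (hC hx hy ha hb hab))]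
  refine iSup_le fun γ => EReal.coe_le_coe_iff.2 ?_
  have h1 := mul_le_mul_of_nonneg_left (sub_log_vectorMGF_le_toReal (hfin x hx) γ) ha
  have h2 := mul_le_mul_of_nonneg_left (sub_log_vectorMGF_le_toReal (hfin y hy) γ) hb
  simp only [inner_add_right, inner_smul_right, smul_eq_mul]
  linear_combination h1 + h2 + Real.log (vectorMGF μ γ) * hab

theorem continuousOn_cramerRate [FiniteDimensional ℝ E] {C : Set E} (hC : Convex ℝ C)
    (hCo : IsOpen C) (hfin : ∀ u ∈ C, cramerRate μ u < ⊤) : ContinuousOn (cramerRate μ) C :=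
  (continuous_coe_real_ereal.comp_continuousOn
    ((convexOn_toReal_cramerRate hC hfin).continuousOn hCo)).congr
    fun u hu => (coe_toReal_cramerRate (hfin u hu)).symm

theorem cramerRate_lt_top_of_le (hμ : ∀ γ : E, Integrable (fun x => Real.exp ⟪γ, x⟫) μ) {u : E}
    {c : ℝ} (hc : 0 < c) (h : ∀ γ, c ≤ Real.exp (-⟪γ, u⟫) * vectorMGF μ γ) :
    cramerRate μ u < ⊤ := by
  refine lt_of_le_of_lt (iSup_le fun γ => EReal.coe_le_coe_iff.2 (?_ : _ ≤ -Real.log c))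
    (EReal.coe_lt_top _)
  have h1 := Real.log_le_log hc (h γ)
  rw [Real.log_mul (Real.exp_pos _).ne' (vectorMGF_pos hμ γ).ne', Real.log_exp] at h1
  linarith

theorem exists_forall_exp_mul_vectorMGF_le [FiniteDimensional ℝ E]
    (hμ : ∀ γ : E, Integrable (fun x => Real.exp ⟪γ, x⟫) μ) {u : E} {c ε : ℝ} (hc : 0 < c)
    (hε : 0 < ε) (h : ∀ γ, c * Real.exp (‖γ‖ * ε) ≤ Real.exp (-⟪γ, u⟫) * vectorMGF μ γ) :
    ∃ γ, ∀ γ', Real.exp (-⟪γ, u⟫) * vectorMGF μ γ ≤ Real.exp (-⟪γ', u⟫) * vectorMGF μ γ' := by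
  have : ProperSpace E := FiniteDimensional.proper ℝ E
  have hcont : Continuous fun γ : E => Real.exp (-⟪γ, u⟫) * vectorMGF μ γ :=
    Continuous.mul (by fun_prop) (continuous_vectorMGF hμ)
  refine hcont.exists_forall_le (tendsto_atTop_mono h ?_)
  exact (Real.tendsto_exp_atTop.comp
    ((tendsto_norm_cocompact_atTop (E := E)).atTop_mul_const hε)).const_mul_atTop hc

/-- Along `γ = -k n` the linear term stays nonnegative, while the moment generating function tends
to zero by dominated convergence. -/
theorem cramerRate_eq_top [BorelSpace E]
    (hμ : ∀ γ : E, Integrable (fun x => Real.exp ⟪γ, x⟫) μ) {u n : E} (hu : ⟪n, u⟫ ≤ 0)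
    (hn : ∀ᵐ x ∂μ, 0 < ⟪n, x⟫) : cramerRate μ u = ⊤ := by
  have ht : Tendsto (fun k : ℕ => vectorMGF μ (-(k : ℝ) • n)) atTop (nhds 0) := by
    have h := tendsto_integral_of_dominated_convergence (μ := μ)
      (F := fun (k : ℕ) x => Real.exp ⟪-(k : ℝ) • n, x⟫) (f := fun _ => 0) (fun _ => 1)
      (fun k => (hμ _).aestronglyMeasurable) (integrable_const 1) (fun k => ?_) ?_
    · rwa [integral_zero] at h
    · filter_upwards [hn] with x hx
      rw [Real.norm_eq_abs, abs_of_pos (Real.exp_pos _), Real.exp_le_one_iff, inner_smul_left]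
      simp only [conj_trivial]
      have : (0 : ℝ) ≤ k := k.cast_nonneg
      nlinarith
    · filter_upwards [hn] with x hx
      have h1 : Tendsto (fun k : ℕ => -((k : ℝ) * ⟪n, x⟫)) atTop atBot :=
        tendsto_neg_atTop_atBot.comp (tendsto_natCast_atTop_atTop.atTop_mul_const hx)
      refine (Real.tendsto_exp_atBot.comp h1).congr fun k => ?_
      simp [inner_smul_left]
  refine EReal.eq_top_iff_forall_lt _ |>.2 fun b => ?_
  obtain ⟨k, hk⟩ := (ht.eventually_lt_const (Real.exp_pos (-b))).exists
  refine lt_of_lt_of_le (EReal.coe_lt_coe_iff.2 ?_) (le_iSup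
    (fun γ => ((⟪γ, u⟫ - Real.log (vectorMGF μ γ) : ℝ) : EReal)) (-(k : ℝ) • n))
  have h1 := (Real.log_lt_iff_lt_exp (vectorMGF_pos hμ _)).2 hk
  have h2 : 0 ≤ ⟪-(k : ℝ) • n, u⟫ := by
    rw [inner_smul_left]
    simp only [conj_trivial]
    have : (0 : ℝ) ≤ k := k.cast_nonneg
    nlinarith
  linarith

end CramerRate

/-! ### Moment generating function and rate of the progress law. -/

section ProgressLaw

variable {lam θ : ℝ}

theorem isProbabilityMeasure_progressLaw (hlam : 0 < lam) (hθ : 0 < θ) (hθ' : θ ≤ Real.pi / 2) :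
    IsProbabilityMeasure (progressLaw lam θ) := ⟨progressLaw_univ hlam hθ hθ'⟩

theorem lintegral_progressLaw {g : Plane → ENNReal} (hg : Measurable g) :
    ∫⁻ x, g x ∂progressLaw lam θ =
      ∫⁻ x in navCone θ, ENNReal.ofReal (progressDensity lam θ x) * g x :=
  lintegral_withDensity_eq_lintegral_mul _
    (measurable_progressDensity lam θ).ennreal_ofReal hg

theorem log_lintegral_progressLaw (hlam : 0 < lam) (hθ : 0 < θ) (hθ' : θ ≤ Real.pi / 2)
    (γ : Plane) :
    ENNReal.log (∫⁻ x, ENNReal.ofReal (Real.exp (inner ℝ γ x)) ∂progressLaw lam θ) =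
      explicitJ lam θ γ := by
  have hm : Measurable fun x : Plane => ENNReal.ofReal (Real.exp (inner ℝ γ x)) := by fun_prop
  rw [lintegral_progressLaw hm, lintegral_navCone hθ hθ'
    (g := fun x => ENNReal.ofReal (progressDensity lam θ x) *
      ENNReal.ofReal (Real.exp (inner ℝ γ x)))
    ((measurable_progressDensity lam θ).ennreal_ofReal.mul hm), explicitJ]
  congr 1
  rw [← lintegral_const_mul' _ _ ENNReal.ofReal_ne_top]
  refine setLIntegral_congr_fun measurableSet_Ioi fun r hr => ?_
  have hr : 0 < r := hr
  dsimp only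
  simp only [progressDensity, norm_polarPoint hr.le]
  simp only [inner_plane, polarPoint, Matrix.cons_val_zero, Matrix.cons_val_one,
    ← mul_assoc]
  rw [lintegral_const_mul' _ _ ENNReal.ofReal_ne_top, ← mul_assoc, ← ENNReal.ofReal_mul hr.le,
    ← ENNReal.ofReal_mul hlam.le]
  congr 2
  ring

theorem integrable_exp_inner_progressLaw (hlam : 0 < lam) (hθ : 0 < θ) (hθ' : θ ≤ Real.pi / 2)
    (γ : Plane) : Integrable (fun x => Real.exp (inner ℝ γ x)) (progressLaw lam θ) := by
  refine ⟨by fun_prop, ?_⟩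
  have hm : Measurable fun x : Plane => ENNReal.ofReal (Real.exp (inner ℝ γ x)) := by fun_prop
  rw [hasFiniteIntegral_iff_ofReal (ae_of_all _ fun x => (Real.exp_pos _).le),
    lintegral_progressLaw hm]
  -- Completing the square spends half of the Gaussian exponent on the linear term. What remains is
  -- `progressDensity (lam / 2)`, of finite mass; the factor `2` restores the prefactor.
  set C := Real.exp (‖γ‖ ^ 2 / (2 * (lam * θ))) with hC
  have hb : 0 < lam * θ := mul_pos hlam hθ
  calc _ ≤ ∫⁻ x in navCone θ, ENNReal.ofReal (2 * C) *
        ENNReal.ofReal (progressDensity (lam / 2) θ x) := by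
        refine lintegral_mono fun x => ?_
        rw [← ENNReal.ofReal_mul (show 0 ≤ progressDensity lam θ x from
            (mul_pos hlam (Real.exp_pos _)).le),
          ← ENNReal.ofReal_mul (by positivity)]
        refine ENNReal.ofReal_le_ofReal ?_
        rw [progressDensity, progressDensity, mul_assoc, ← Real.exp_add,
          show 2 * C * (lam / 2 * Real.exp (-(lam / 2) * θ * ‖x‖ ^ 2)) =
            lam * (C * Real.exp (-(lam / 2) * θ * ‖x‖ ^ 2)) by ring, hC, ← Real.exp_add]
        refine mul_le_mul_of_nonneg_left (Real.exp_le_exp.2 ?_) hlam.le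
        have h1 : inner ℝ γ x ≤ ‖γ‖ * ‖x‖ := real_inner_le_norm γ x
        have h2 : ‖γ‖ * ‖x‖ ≤ ‖γ‖ ^ 2 / (2 * (lam * θ)) + lam * θ / 2 * ‖x‖ ^ 2 := by
          have h3 : ‖γ‖ ^ 2 / (2 * (lam * θ)) + lam * θ / 2 * ‖x‖ ^ 2 - ‖γ‖ * ‖x‖ =
              (‖γ‖ - lam * θ * ‖x‖) ^ 2 / (2 * (lam * θ)) := by
            field_simp
            ring
          have h4 : 0 ≤ (‖γ‖ - lam * θ * ‖x‖) ^ 2 / (2 * (lam * θ)) := by positivity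
          linarith
        linarith
    _ = ENNReal.ofReal (2 * C) * progressLaw (lam / 2) θ univ := by
        rw [lintegral_const_mul _ (measurable_progressDensity _ θ).ennreal_ofReal, progressLaw,
          withDensity_apply _ MeasurableSet.univ, Measure.restrict_univ]
    _ < ⊤ := by
        rw [progressLaw_univ (half_pos hlam) hθ hθ', mul_one]
        exact ENNReal.ofReal_lt_top

theorem explicitJ_eq_coe_log (hlam : 0 < lam) (hθ : 0 < θ) (hθ' : θ ≤ Real.pi / 2) (γ : Plane) :
    explicitJ lam θ γ = (Real.log (vectorMGF (progressLaw lam θ) γ) : ℝ) := by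
  have := isProbabilityMeasure_progressLaw hlam hθ hθ'
  have hint := integrable_exp_inner_progressLaw hlam hθ hθ'
  rw [← log_lintegral_progressLaw hlam hθ hθ', ← ofReal_integral_eq_lintegral_ofReal (hint γ)
    (ae_of_all _ fun x => (Real.exp_pos _).le)]
  exact ENNReal.log_ofReal_of_pos (vectorMGF_pos hint γ)

theorem rateFunction_eq_cramerRate (hlam : 0 < lam) (hθ : 0 < θ) (hθ' : θ ≤ Real.pi / 2) :
    rateFunction lam θ = cramerRate (progressLaw lam θ) := by
  ext u
  simp only [rateFunction, cramerRate, explicitJ_eq_coe_log hlam hθ hθ', EReal.coe_sub]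

/-- The law has a density, so it does not charge the line orthogonal to the normal. -/
theorem ae_progressLaw_inner_coneNormal_pos (hθ : 0 < θ) (hθ' : θ ≤ Real.pi / 2) {s : ℝ}
    (hs : ∀ x ∈ navCone θ, 0 ≤ inner ℝ (coneNormal θ s) x) :
    ∀ᵐ x ∂progressLaw lam θ, 0 < inner ℝ (coneNormal θ s) x := by
  refine (withDensity_absolutelyContinuous _ _).ae_le ?_
  have hnull : volume ((Submodule.orthogonal (Submodule.span ℝ {coneNormal θ s}) :
      Submodule ℝ Plane) : Set Plane) = 0 := by
    refine Measure.addHaar_submodule _ _ fun h => coneNormal_ne_zero hθ hθ' s ?_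
    have : coneNormal θ s ∈ Submodule.orthogonal (Submodule.span ℝ {coneNormal θ s}) :=
      h ▸ Submodule.mem_top
    rwa [Submodule.mem_orthogonal_singleton_iff_inner_right, inner_self_eq_zero] at this
  filter_upwards [ae_restrict_mem (measurableSet_navCone hθ hθ'),
    ae_restrict_of_ae (measure_eq_zero_iff_ae_notMem.1 hnull)] with x hx hx'
  refine lt_of_le_of_ne (hs x hx) fun h => hx' ?_
  rw [SetLike.mem_coe, Submodule.mem_orthogonal_singleton_iff_inner_right]
  exact h.symm

/-- With `e` the direction of `γ`, the ball of radius `ε` about `u + 2εe` stays in the cone, and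
`⟪γ, x⟫ ≥ ⟪γ, u⟫ + ε‖γ‖` on it. Its mass is bounded below uniformly in `e`, by translation
invariance and a lower bound on the density. Markov's inequality concludes. -/
theorem exists_pos_mul_exp_le (hlam : 0 < lam) (hθ : 0 < θ) (hθ' : θ ≤ Real.pi / 2) {u : Plane}
    (hu : u ∈ interior (navCone θ)) :
    ∃ c ε : ℝ, 0 < c ∧ 0 < ε ∧ ∀ γ, c * Real.exp (‖γ‖ * ε) ≤
      Real.exp (-inner ℝ γ u) * vectorMGF (progressLaw lam θ) γ := by
  have := isProbabilityMeasure_progressLaw hlam hθ hθ'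
  obtain ⟨ρ, hρ, hball⟩ := Metric.mem_nhds_iff.1 (mem_interior_iff_mem_nhds.1 hu)
  -- The shifted ball reaches distance at most `3ε < ρ` from `u`.
  set ε := ρ / 4 with hε
  have hε0 : 0 < ε := by positivity
  set d := lam * Real.exp (-lam * θ * (‖u‖ + ρ) ^ 2) with hd
  have hd0 : 0 < d := mul_pos hlam (Real.exp_pos _)
  have hvol : 0 < volume.real (Metric.ball (0 : Plane) ε) :=
    ENNReal.toReal_pos (Metric.measure_ball_pos _ _ hε0).ne' measure_ball_lt_top.ne
  refine ⟨d * volume.real (Metric.ball (0 : Plane) ε), ε, mul_pos hd0 hvol, hε0, fun γ => ?_⟩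
  obtain ⟨e, he, heγ⟩ : ∃ e : Plane, ‖e‖ ≤ 1 ∧ inner ℝ γ e = ‖γ‖ := by
    rcases eq_or_ne γ 0 with rfl | hγ
    · exact ⟨0, by simp⟩
    · have hγ0 : ‖γ‖ ≠ 0 := norm_ne_zero_iff.2 hγ
      refine ⟨‖γ‖⁻¹ • γ, by simp [norm_smul, hγ0], ?_⟩
      rw [inner_smul_right, real_inner_self_eq_norm_sq]
      field_simp
  set B := Metric.ball (u + (2 * ε) • e) ε with hB
  have hBu : ∀ x ∈ B, ‖x - u‖ < ρ := by
    intro x hx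
    have h1 : ‖x - (u + (2 * ε) • e)‖ < ε := mem_ball_iff_norm.1 hx
    have h2 : ‖(2 * ε) • e‖ ≤ 2 * ε := by
      rw [norm_smul, Real.norm_eq_abs, abs_of_pos (by positivity)]
      nlinarith
    calc ‖x - u‖ = ‖(x - (u + (2 * ε) • e)) + (2 * ε) • e‖ := by congr 1; abel
      _ ≤ _ := norm_add_le _ _
      _ < ρ := by linarith
  have hBcone : B ⊆ navCone θ := fun x hx => hball (mem_ball_iff_norm.2 (hBu x hx))
  have hinner : ∀ x ∈ B, Real.exp (inner ℝ γ u + ‖γ‖ * ε) ≤ Real.exp (inner ℝ γ x) := by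
    intro x hx
    refine Real.exp_le_exp.2 ?_
    have h1 : ‖(u + (2 * ε) • e) - x‖ < ε := by
      rw [norm_sub_rev]
      exact mem_ball_iff_norm.1 hx
    have h2 := real_inner_le_norm γ ((u + (2 * ε) • e) - x)
    rw [inner_sub_right, inner_add_right, inner_smul_right, heγ] at h2
    nlinarith [norm_nonneg γ]
  have hμB : d * volume.real (Metric.ball (0 : Plane) ε) ≤ (progressLaw lam θ).real B := by
    refine (ENNReal.ofReal_le_iff_le_toReal (measure_ne_top _ _)).1 ?_
    rw [ENNReal.ofReal_mul hd0.le, ofReal_measureReal measure_ball_lt_top.ne, progressLaw,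
      withDensity_apply _ measurableSet_ball, Measure.restrict_restrict measurableSet_ball,
      inter_eq_self_of_subset_left hBcone,
      ← Measure.addHaar_ball_center volume (u + (2 * ε) • e), ← setLIntegral_const]
    refine setLIntegral_mono_ae' measurableSet_ball (ae_of_all _ fun x hx => ?_)
    refine ENNReal.ofReal_le_ofReal
      (mul_le_mul_of_nonneg_left (Real.exp_le_exp.2 ?_) hlam.le)
    have h1 : ‖x‖ ≤ ‖u‖ + ρ := by
      have := norm_le_norm_add_norm_sub' x u
      linarith [hBu x hx]
    have h2 := pow_le_pow_left₀ (norm_nonneg x) h1 2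
    have h3 : 0 < lam * θ := mul_pos hlam hθ
    nlinarith
  have hmarkov := mul_meas_ge_le_integral_of_nonneg
    (ae_of_all _ fun x => (Real.exp_pos (inner ℝ γ x)).le)
    (integrable_exp_inner_progressLaw hlam hθ hθ' γ) (Real.exp (inner ℝ γ u + ‖γ‖ * ε))
  have hmono : (progressLaw lam θ).real B ≤
      (progressLaw lam θ).real {x | Real.exp (inner ℝ γ u + ‖γ‖ * ε) ≤ Real.exp (inner ℝ γ x)} :=
    measureReal_mono hinner (measure_ne_top _ _)
  have hfin : Real.exp (inner ℝ γ u + ‖γ‖ * ε) * (d * volume.real (Metric.ball (0 : Plane) ε)) ≤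
      vectorMGF (progressLaw lam θ) γ :=
    (mul_le_mul_of_nonneg_left (hμB.trans hmono) (Real.exp_pos _).le).trans hmarkov
  have := mul_le_mul_of_nonneg_left hfin (Real.exp_pos (-inner ℝ γ u)).le
  rwa [← mul_assoc, ← Real.exp_add, neg_add_cancel_left, mul_comm (Real.exp _)] at this

theorem setOf_cramerRate_progressLaw_lt_top (hlam : 0 < lam) (hθ : 0 < θ)
    (hθ' : θ ≤ Real.pi / 2) :
    {u | cramerRate (progressLaw lam θ) u < ⊤} = interior (navCone θ) := by
  have := isProbabilityMeasure_progressLaw hlam hθ hθ'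
  have hint := integrable_exp_inner_progressLaw hlam hθ hθ'
  ext u
  refine ⟨fun hu => ?_, fun hu => ?_⟩
  · have hu : cramerRate (progressLaw lam θ) u < ⊤ := hu
    rw [interior_navCone hθ hθ']
    constructor
    · by_contra! h
      exact hu.ne (cramerRate_eq_top hint h (ae_progressLaw_inner_coneNormal_pos hθ hθ'
        fun x hx => ((mem_navCone_iff hθ hθ').1 hx).2.1))
    · by_contra! h
      exact hu.ne (cramerRate_eq_top hint h (ae_progressLaw_inner_coneNormal_pos hθ hθ'
        fun x hx => ((mem_navCone_iff hθ hθ').1 hx).2.2))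
  · obtain ⟨c, ε, hc, hε, h⟩ := exists_pos_mul_exp_le hlam hθ hθ' hu
    refine cramerRate_lt_top_of_le hint hc fun γ => le_trans ?_ (h γ)
    exact le_mul_of_one_le_right hc.le (Real.one_le_exp (by positivity))

end ProgressLaw

/-! ### The main theorem. -/

theorem lemma2p3 {Ω Ω' : Type*} [MeasurableSpace Ω] [MeasurableSpace Ω']
    (Pr : Measure Ω) [IsProbabilityMeasure Pr] (Pr' : Measure Ω') [IsProbabilityMeasure Pr']
    (lam θ : ℝ) (hlam : 0 < lam) (hθ : 0 < θ) (hθ' : θ ≤ Real.pi / 2)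
    (P : Ω → Set Plane)
    (hP : IsPoissonProcess P (ENNReal.ofReal lam • (volume : Measure Plane)) Pr)
    (U : ℕ → Ω' → Plane)
    (hU_indep : iIndepFun U Pr')
    (hU_law : ∀ i, IdentDistrib (U i) (fun ω => progress θ (P ω) 1) Pr' Pr) :
    SatisfiesLDP Pr' (fun n ω => (n : ℝ)⁻¹ • ∑ i ∈ Finset.range n, U i ω) (fun n => (n : ℝ))
      (rateFunction lam θ) ∧
    (∀ γ : Plane,
      ENNReal.log (∫⁻ ω, ENNReal.ofReal (Real.exp (inner ℝ γ (progress θ (P ω) 1))) ∂Pr) =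
        explicitJ lam θ γ) ∧
    (∀ γ : Plane, ⊥ < explicitJ lam θ γ ∧ explicitJ lam θ γ < ⊤) ∧
    {u : Plane | rateFunction lam θ u < ⊤} = interior (navCone θ) ∧
    ContinuousOn (rateFunction lam θ) {u : Plane | rateFunction lam θ u < ⊤} := by
  have hprob := isProbabilityMeasure_progressLaw hlam hθ hθ'
  have hint := integrable_exp_inner_progressLaw hlam hθ hθ'
  have hdom := setOf_cramerRate_progressLaw_lt_top hlam hθ hθ'
  -- Measurability of the progress is part of `IdentDistrib`, so it need not be derived from the
  -- counts.
  have hm := (hU_law 0).aemeasurable_snd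
  have hmap := map_progress_one hlam hθ hθ' hP hm
  have hlaw : ∀ i, HasLaw (U i) (progressLaw lam θ) Pr' := fun i =>
    ⟨(hU_law i).aemeasurable_fst, (hU_law i).map_eq.trans hmap⟩
  rw [rateFunction_eq_cramerRate hlam hθ hθ']
  refine ⟨satisfiesLDP_cramerRate hint (fun u hu => ?_) hU_indep hlaw, fun γ => ?_, fun γ => ?_,
    hdom, ?_⟩
  · obtain ⟨c, ε, hc, hε, h⟩ := exists_pos_mul_exp_le hlam hθ hθ' (hdom.subset hu)
    exact exists_forall_exp_mul_vectorMGF_le hint hc hε h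
  · rw [← log_lintegral_progressLaw hlam hθ hθ', ← hmap, lintegral_map' (by fun_prop) hm]
  · rw [explicitJ_eq_coe_log hlam hθ hθ']
    exact ⟨EReal.bot_lt_coe _, EReal.coe_lt_top _⟩
  · rw [hdom]
    exact continuousOn_cramerRate (convex_interior_navCone hθ hθ') isOpen_interior
      fun u hu => hdom.superset hu
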